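/- Let $F$ be an absolutely continuous distribution function (df) on $\mathbb{R}$ with probability density function (pdf) $f$, let $k\ge 1$ be an integer and $r>0$ real. Write $B(r,k)=\Gamma(r)\Gamma(k)/\Gamma(r+k)$, $r(G)=\sup\{x\in\mathbb{R}: G(x)<1\}\in(-\infty,\infty]$ and $G^-(y)=\inf\{x: G(x)\ge y\}$ for a df $G$, and $H_k=1-(1-F)^k$. Define $$T_k(x)=\sum_{l=0}^{k-1}\binom{l+r-1}{l}\frac{(-\ln F(x))^l}{(1-\ln F(x))^{l+r}}\quad\text{if } F(x)>0,\qquad T_k(x)=0\quad\text{if } F(x)=0,$$ where $\binom{l+r-1}{l}=r(r+1)\cdots(r+l-1)/l!$. Let $\Phi_\alpha(x)=\exp(-x^{-\alpha})$ for $x>0$ and $0$ for $x\le 0$; $\Psi_\alpha(x)=\exp(-|x|^{\alpha})$ for $x<0$ and $1$ for $x\ge 0$; $\Lambda(x)=\exp(-e^{-x})$. For dfs $G$ and $L$ we say that $G$ is attracted to $L$ with norming constants $a_n,b_n$ if $a_n>0$ for all large $n$ and $G^n(a_nx+b_n)\to L(x)$ as $n\to\infty$ at all continuity points $x$ of $L$;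 $D_l(L)$ is the set of dfs attracted to $L$ with some norming constants. Two dfs $G_1,G_2$ are tail equivalent if $r(G_1)=r(G_2)=:\rho$ and $(1-G_1(x))/(1-G_2(x))$ tends to a constant in $(0,\infty)$ as $x\uparrow \rho$. An auxiliary function of $F$ is a function $v$, positive on $\{t\in\mathbb{R}: t<r(F)\}$, with $\lim_{t\uparrow r(F)}\frac{1-F(t+v(t)x)}{1-F(t)}=e^{-x}$ for all $x\ge 0$. Then: (a) $T_k$ is a df, absolutely continuous with pdf $$t_k(x)=\frac{1}{B(r,k)}\,\frac{f(x)}{F(x)}\,\frac{(-\ln F(x))^{k-1}}{(1-\ln F(x))^{r+k}}\ \text{ if } F(x)>0,\qquad t_k(x)=0\ \text{ if } F(x)=0;$$ moreover $r(T_k)=r(F)$ and $$\lim_{x\uparrow r(F)}\frac{1-T_k(x)}{(1-F(x))^k}=\frac{1}{k\,B(r,k)},$$ so that $T_k$ is tail equivalent to $H_k$. (b) If $F\in D_l(\Phi_\alpha)$ with $\alpha>0$, then $r(T_k)=r(F)=\infty$ and $T_k\in D_l(\Phi_{k\alpha})$; one may take the norming constants $a_n=F^-\big(1-(kB(r,k)/n)^{1/k}\big)$,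 $b_n=0$. (c) If $F\in D_l(\Psi_\alpha)$ with $\alpha>0$, then $r(T_k)=r(F)<\infty$ and $T_k\in D_l(\Psi_{k\alpha})$; one may take the norming constants $a_n=r(F)-F^-\big(1-(kB(r,k)/n)^{1/k}\big)$, $b_n=r(F)$. (d) If $F\in D_l(\Lambda)$, then $r(T_k)=r(F)$ and $T_k\in D_l(\Lambda)$; moreover $F$ has an auxiliary function, and for every auxiliary function $v$ of $F$ one may take the norming constants $b_n=T_k^-(1-1/n)$, $a_n=v(b_n)/k$. (In (b)-(d) the given expressions matter, and are well defined, for all large $n$ only.) -/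

import Mathlib

open Filter Topology MeasureTheory

noncomputable section

namespace KthExtremes

/-- `F` is the distribution function of a real random variable. -/
structure IsDF (F : ℝ → ℝ) : Prop where
  mono : Monotone F
  rightCts : ∀ x, ContinuousWithinAt F (Set.Ici x) x
  atBot : Tendsto F atBot (𝓝 0)
  atTop : Tendsto F atTop (𝓝 1)

/-- `F` is absolutely continuous with probability density function `f`. -/
structure HasDensity (F f : ℝ → ℝ) : Prop where
  nonneg : ∀ x, 0 ≤ f x
  integrable : Integrable f volume
  eq_integral : ∀ x, F x = ∫ t in Set.Iic x, f t

/-- The right extremity `r(F) = sup {x ∈ ℝ : F x < 1}`, possibly `∞`. -/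
def rightEnd (F : ℝ → ℝ) : EReal :=
  sSup (Real.toEReal '' {x : ℝ | F x < 1})

/-- The filter of real `x` tending to `r(F)` from the left (`x → ∞` if `r(F) = ∞`). -/
def toRightEnd (F : ℝ → ℝ) : Filter ℝ :=
  comap Real.toEReal (𝓝[<] rightEnd F)

/-- The left-continuous inverse `F⁻(y) = inf {x : F x ≥ y}`; it is a genuine infimum of a nonempty
set that is bounded below whenever `F` is a distribution function and `0 < y < 1`. -/
def genInv (F : ℝ → ℝ) (y : ℝ) : ℝ :=
  sInf {x : ℝ | y ≤ F x}

/-- The Fréchet law. -/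
def frechet (α x : ℝ) : ℝ :=
  if 0 < x then Real.exp (-(x ^ (-α))) else 0

/-- The Weibull law. -/
def weibull (α x : ℝ) : ℝ :=
  if x < 0 then Real.exp (-(|x| ^ α)) else 1

/-- The Gumbel law. -/
def gumbel (x : ℝ) : ℝ :=
  Real.exp (-Real.exp (-x))

/-- `F ^ n (a_n x + b_n) → G x` at all continuity points `x` of `G`. As finitely many terms do not
matter for the limit, positivity of the `a_n` is only asked for all large `n`. -/
def MaxConverges (F G : ℝ → ℝ) (a b : ℕ → ℝ) : Prop :=
  (∀ᶠ n in atTop, 0 < a n) ∧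
    ∀ x, ContinuousAt G x → Tendsto (fun n : ℕ => F (a n * x + b n) ^ n) atTop (𝓝 (G x))

/-- `F` belongs to the max domain of attraction of `G` under linear normalization. -/
def InMaxDomain (F G : ℝ → ℝ) : Prop :=
  ∃ a b : ℕ → ℝ, MaxConverges F G a b

/-- `v` is an auxiliary function of `F` for attraction to the Gumbel law: it is positive to the left
of `r(F)`, and `(1 - F (t + v t * x)) / (1 - F t) → exp (-x)` as `t ↑ r(F)` for all `x ≥ 0`. -/
def IsAuxiliary (F v : ℝ → ℝ) : Prop :=
  (∀ t : ℝ, (t : EReal) < rightEnd F → 0 < v t) ∧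
    ∀ x : ℝ, 0 ≤ x →
      Tendsto (fun t => (1 - F (t + v t * x)) / (1 - F t)) (toRightEnd F) (𝓝 (Real.exp (-x)))

/-- Tail equivalence: the same right extremity, and the ratio of the tails tends there to a finite
positive constant. -/
def TailEquivalent (F G : ℝ → ℝ) : Prop :=
  rightEnd F = rightEnd G ∧
    ∃ c : ℝ, 0 < c ∧ Tendsto (fun x => (1 - F x) / (1 - G x)) (toRightEnd G) (𝓝 c)

/-- `H_k = 1 - (1 - F) ^ k`. -/
def H (F : ℝ → ℝ) (k : ℕ) (x : ℝ) : ℝ :=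
  1 - (1 - F x) ^ k

/-- `T_k`, extended by `0` to the points where `F` vanishes. `Ring.choose` is the generalized
binomial coefficient with real upper argument. -/
def T (F : ℝ → ℝ) (r : ℝ) (k : ℕ) (x : ℝ) : ℝ :=
  if 0 < F x then
    ∑ l ∈ Finset.range k, Ring.choose ((l : ℝ) + r - 1) l *
      ((-Real.log (F x)) ^ l / (1 - Real.log (F x)) ^ ((l : ℝ) + r))
  else 0

/-- The density of `T_k`, extended by `0` to the points where `F` vanishes. -/
def tDensity (F f : ℝ → ℝ) (r : ℝ) (k : ℕ) (x : ℝ) : ℝ :=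
  if 0 < F x then
    1 / ProbabilityTheory.beta r k * (f x / F x) *
      ((-Real.log (F x)) ^ (k - 1) / (1 - Real.log (F x)) ^ (r + (k : ℝ)))
  else 0

end KthExtremes

end

/-! The function $T_k$ is a fixed kernel composed with $F$. In the variable $s=-\ln y$ the
derivative of the kernel telescopes to a single term, so the kernel is a continuous, strictly
increasing df on $[0,1]$ with explicit derivative (`hasDerivAt_sum_negBinomial`,
`strictMonoOn_kernel`). Its density claim transfers to $T_k$ because $F$ maps the law with density
$f$ to the uniform law (`HasDensity.map_lawOf`). L'Hôpital at $y=1$ gives $1-T_k\sim(1-F)^k/(kB)$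
(`tendsto_one_sub_kernel_div`).

For the domains of attraction, $y_n^n\to e^{-c}$ is the same as $n(1-y_n)\to c$. Attraction of $F$
thus says that its tail at $a_nx+b_n$, divided by $1/n$, tends to $\varphi(x)=-\ln L(x)$; taking
integer parts of $1/p$ extends this to any scale $p\to0^+$ (`ScaledTail.of_nat`). If $np_n^k\to kB$
and $(1-F(z_n))/p_n\to\varphi(x)$, then $n(1-T_k(z_n))\to\varphi(x)^k$ (`tendsto_T_pow`), which is
the exponent of the limit law for $T_k$, up to the factor $1/k$ in the Gumbel scale.

The stated norming constants require the classical facts on $F$: no centering for Fréchet, finite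
endpoint as centre for Weibull, tail ratios on the whole line for Gumbel. The first two come from
comparing the indices $n$ and $n/2$ (`ScaledTail.half`), where the scales change by a factor bounded
away from $1$ and the errors form geometric series. The last follows by centering at $t$ on the
scale $1-F(t)$. -/

noncomputable section

namespace KthExtremes

/-! ### The kernel on the unit interval. -/

/-- The function `y ↦ T_k` at `F x = y`, so that `T F r k x = kernel r k (F x)`. -/
def kernel (r : ℝ) (k : ℕ) (y : ℝ) : ℝ :=
  if 0 < y then
    ∑ l ∈ Finset.range k, Ring.choose ((l : ℝ) + r - 1) l *
      ((-Real.log y) ^ l / (1 - Real.log y) ^ ((l : ℝ) + r))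
  else 0

/-- The derivative of `kernel r k` on the unit interval. -/
def kernelDeriv (r : ℝ) (k : ℕ) (y : ℝ) : ℝ :=
  if 0 < y then
    1 / ProbabilityTheory.beta r k * (1 / y) *
      ((-Real.log y) ^ (k - 1) / (1 - Real.log y) ^ (r + (k : ℝ)))
  else 0

lemma T_eq_kernel (F : ℝ → ℝ) (r : ℝ) (k : ℕ) (x : ℝ) : T F r k x = kernel r k (F x) := rfl

lemma tDensity_eq (F f : ℝ → ℝ) (r : ℝ) (k : ℕ) (x : ℝ) :
    tDensity F f r k x = f x * kernelDeriv r k (F x) := by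
  unfold tDensity kernelDeriv
  split_ifs
  · ring
  · simp

/-- The recursion of the negative binomial coefficients. -/
lemma succ_mul_choose (r : ℝ) (l : ℕ) :
    ((l : ℝ) + 1) * Ring.choose (((l + 1 : ℕ) : ℝ) + r - 1) (l + 1) =
      (l + r) * Ring.choose ((l : ℝ) + r - 1) l := by
  have h : ∀ n : ℕ, (n.factorial : ℝ) * Ring.choose ((n : ℝ) + r - 1) n =
      Polynomial.eval r (ascPochhammer ℝ n) := by
    intro n
    rw [← Polynomial.ascPochhammer_smeval_eq_eval,
      ← Ring.factorial_nsmul_multichoose_eq_ascPochhammer, Ring.multichoose_eq, nsmul_eq_mul,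
      add_comm r]
  have h1 := h (l + 1)
  rw [ascPochhammer_succ_eval, ← h l, Nat.factorial_succ] at h1
  have h2 : (l.factorial : ℝ) ≠ 0 := by positivity
  apply mul_left_cancel₀ h2
  push_cast at h1 ⊢
  linarith

lemma beta_pos {r : ℝ} (hr : 0 < r) {k : ℕ} (hk : 1 ≤ k) : 0 < ProbabilityTheory.beta r k :=
  ProbabilityTheory.beta_pos hr (by exact_mod_cast hk)

/-- Matches the coefficient surviving the telescoping with the constant of the density, by induction
with $\Gamma(x+1)=x\Gamma(x)$. -/
lemma mul_choose_eq_inv_beta {r : ℝ} (hr : 0 < r) {k : ℕ} (hk : 1 ≤ k) :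
    (k : ℝ) * Ring.choose ((k : ℝ) + r - 1) k = 1 / ProbabilityTheory.beta r k := by
  induction k, hk using Nat.le_induction with
  | base =>
    have h := succ_mul_choose r 0
    simp only [Nat.cast_zero, zero_add, one_mul, Ring.choose_zero_right, mul_one] at h
    rw [h]
    simp [ProbabilityTheory.beta, Real.Gamma_add_one hr.ne', (Real.Gamma_pos_of_pos hr).ne']
  | succ n hn ih =>
    have hn' : (0 : ℝ) < n := by exact_mod_cast hn
    rw [← Nat.succ_eq_add_one]
    have h := succ_mul_choose r n
    have h1 : ((n.succ : ℕ) : ℝ) = n + 1 := by push_cast; ring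
    rw [h1]
    rw [← Nat.succ_eq_add_one, h1] at h
    rw [h]
    have h2 : Ring.choose ((n : ℝ) + r - 1) n = 1 / ProbabilityTheory.beta r n / n := by
      rw [← ih]; field_simp
    rw [h2]
    unfold ProbabilityTheory.beta
    rw [Real.Gamma_add_one hn'.ne', ← add_assoc, Real.Gamma_add_one (by positivity)]
    have := Real.Gamma_pos_of_pos hr
    have := Real.Gamma_pos_of_pos hn'
    have := Real.Gamma_pos_of_pos (add_pos hr hn')
    field_simp
    ring

/-- Telescoping: with $c_l$ the binomial coefficient and $D_l=l\,c_l\,s^{l-1}/(1+s)^{l+r}$, the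
$l$-th term has derivative $D_l-D_{l+1}$ because $(l+1)c_{l+1}=(l+r)c_l$. Only $-D_k$ remains. -/
lemma hasDerivAt_sum_negBinomial (r : ℝ) (k : ℕ) {s : ℝ} (hs : 0 ≤ s) :
    HasDerivAt (fun s : ℝ => ∑ l ∈ Finset.range k, Ring.choose ((l : ℝ) + r - 1) l *
      (s ^ l / (1 + s) ^ ((l : ℝ) + r)))
      (-(k * Ring.choose ((k : ℝ) + r - 1) k * (s ^ (k - 1) / (1 + s) ^ (r + (k : ℝ))))) s := by
  induction k with
  | zero => simpa using hasDerivAt_const s (0 : ℝ)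
  | succ k ih =>
    have hs1 : 0 < 1 + s := by linarith
    have h1 : HasDerivAt (fun s : ℝ => (1 + s) ^ (-((k : ℝ) + r)))
        (1 * (-((k : ℝ) + r)) * (1 + s) ^ (-((k : ℝ) + r) - 1)) s :=
      ((hasDerivAt_id s).const_add 1).rpow_const (Or.inl hs1.ne')
    have h2 := ((hasDerivAt_pow k s).mul h1).const_mul (Ring.choose ((k : ℝ) + r - 1) k)
    have h3 := ih.add h2
    refine (h3.congr_of_eventuallyEq ?_).congr_deriv ?_
    · filter_upwards [lt_mem_nhds (show -1 < s by linarith)] with u hu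
      rw [Finset.sum_range_succ]
      simp only [Pi.add_apply, Pi.mul_apply]
      congr 2
      rw [Real.rpow_neg (by linarith), div_eq_mul_inv]
    rw [← Nat.succ_eq_add_one]
    have h4 := succ_mul_choose r k
    have h5 : ((k.succ : ℕ) : ℝ) = k + 1 := by push_cast; ring
    rw [← Nat.succ_eq_add_one, h5] at h4
    rw [h5, h4, Nat.succ_sub_one, Real.rpow_neg hs1.le, Real.rpow_sub hs1, Real.rpow_neg hs1.le,
      Real.rpow_one, ← add_assoc, Real.rpow_add_one hs1.ne', add_comm r]
    have := (Real.rpow_pos_of_pos hs1 (k + r)).ne'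
    field_simp
    ring

lemma kernel_one {r : ℝ} {k : ℕ} (hk : 1 ≤ k) : kernel r k 1 = 1 := by
  obtain ⟨m, rfl⟩ := Nat.exists_eq_add_of_le' hk
  simp [kernel, Finset.sum_range_succ']

lemma kernel_zero (r : ℝ) (k : ℕ) : kernel r k 0 = 0 := by simp [kernel]

lemma hasDerivAt_kernel {r : ℝ} (hr : 0 < r) {k : ℕ} (hk : 1 ≤ k) {y : ℝ} (h0 : 0 < y)
    (h1 : y ≤ 1) : HasDerivAt (kernel r k) (kernelDeriv r k y) y := by
  have hs : 0 ≤ -Real.log y := by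
    have := Real.log_nonpos h0.le h1
    linarith
  have h := (hasDerivAt_sum_negBinomial r k hs).comp y (Real.hasDerivAt_log h0.ne').neg
  refine (h.congr_of_eventuallyEq ?_).congr_deriv ?_
  · filter_upwards [lt_mem_nhds h0] with u hu
    simp [kernel, hu, sub_eq_add_neg]
  · rw [mul_choose_eq_inv_beta hr hk, kernelDeriv, if_pos h0, ← sub_eq_add_neg]
    ring

lemma kernelDeriv_nonneg {r : ℝ} (hr : 0 < r) {k : ℕ} (hk : 1 ≤ k) {y : ℝ} (h1 : y ≤ 1) :
    0 ≤ kernelDeriv r k y := by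
  unfold kernelDeriv
  split_ifs with h0
  · have h := Real.log_nonpos h0.le h1
    have := beta_pos hr hk
    have : 0 ≤ -Real.log y := by linarith
    have : 0 ≤ 1 - Real.log y := by linarith
    positivity
  · exact le_rfl

lemma kernelDeriv_pos {r : ℝ} (hr : 0 < r) {k : ℕ} (hk : 1 ≤ k) {y : ℝ} (h0 : 0 < y)
    (h1 : y < 1) : 0 < kernelDeriv r k y := by
  unfold kernelDeriv
  rw [if_pos h0]
  have h := Real.log_neg h0 h1
  have := beta_pos hr hk
  have : 0 < -Real.log y := by linarith
  have : 0 < 1 - Real.log y := by linarith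
  positivity

lemma measurable_kernelDeriv (r : ℝ) (k : ℕ) : Measurable (kernelDeriv r k) := by
  unfold kernelDeriv
  refine Measurable.ite measurableSet_Ioi ?_ measurable_const
  fun_prop

lemma tendsto_kernel_zero {r : ℝ} (hr : 0 < r) (k : ℕ) :
    Tendsto (kernel r k) (𝓝[>] 0) (𝓝 0) := by
  have hL : Tendsto (fun y => -Real.log y) (𝓝[>] 0) atTop :=
    tendsto_neg_atBot_atTop.comp Real.tendsto_log_nhdsGT_zero
  have hS : Tendsto (fun s : ℝ => ∑ l ∈ Finset.range k, Ring.choose ((l : ℝ) + r - 1) l *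
      (s ^ l / (1 + s) ^ ((l : ℝ) + r))) atTop (𝓝 0) := by
    rw [← Finset.sum_const_zero (s := Finset.range k)]
    refine tendsto_finsetSum _ fun l _ => ?_
    rw [← mul_zero (Ring.choose ((l : ℝ) + r - 1) l)]
    refine Tendsto.const_mul _ ?_
    have h1 : Tendsto (fun s : ℝ => (1 + s) ^ (-r)) atTop (𝓝 0) :=
      (tendsto_rpow_neg_atTop hr).comp (tendsto_atTop_add_const_left _ _ tendsto_id)
    -- Since $s\le 1+s$, each quotient is at most $(1+s)^{-r}$.
    refine squeeze_zero' ?_ ?_ h1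
    · filter_upwards [eventually_gt_atTop 0] with s hs
      positivity
    · filter_upwards [eventually_gt_atTop 0] with s hs
      have hs1 : 0 < 1 + s := by linarith
      rw [Real.rpow_add hs1, Real.rpow_neg hs1.le, Real.rpow_natCast, div_mul_eq_div_div,
        div_eq_mul_inv _ ((1 + s) ^ r)]
      refine mul_le_of_le_one_left (by positivity) ?_
      rw [div_le_one (by positivity)]
      gcongr
      linarith
  refine (hS.comp hL).congr' ?_
  filter_upwards [self_mem_nhdsWithin] with y hy
  have hy' : 0 < y := hy
  simp [kernel, hy', sub_eq_add_neg]

lemma continuousOn_kernel {r : ℝ} (hr : 0 < r) {k : ℕ} (hk : 1 ≤ k) :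
    ContinuousOn (kernel r k) (Set.Icc 0 1) := by
  intro y hy
  rcases hy.1.eq_or_lt with rfl | h0
  · have h : ContinuousWithinAt (kernel r k) (Set.Ioi 0) 0 := by
      rw [ContinuousWithinAt, kernel_zero]
      exact tendsto_kernel_zero hr k
    exact (continuousWithinAt_Ioi_iff_Ici.1 h).mono Set.Icc_subset_Ici_self
  · exact (hasDerivAt_kernel hr hk h0 hy.2).continuousAt.continuousWithinAt

lemma strictMonoOn_kernel {r : ℝ} (hr : 0 < r) {k : ℕ} (hk : 1 ≤ k) :
    StrictMonoOn (kernel r k) (Set.Icc 0 1) := by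
  refine strictMonoOn_of_deriv_pos (convex_Icc 0 1) (continuousOn_kernel hr hk) fun y hy => ?_
  rw [interior_Icc] at hy
  rw [(hasDerivAt_kernel hr hk hy.1 hy.2.le).deriv]
  exact kernelDeriv_pos hr hk hy.1 hy.2

/-- The derivative is unbounded near $0$; integrability comes from its being the nonnegative
derivative of a function continuous up to $0$. -/
lemma integrableOn_kernelDeriv {r : ℝ} (hr : 0 < r) {k : ℕ} (hk : 1 ≤ k) {y : ℝ} (h1 : y ≤ 1) :
    IntegrableOn (kernelDeriv r k) (Set.Ioc 0 y) :=
  intervalIntegral.integrableOn_deriv_of_nonneg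
    ((continuousOn_kernel hr hk).mono (Set.Icc_subset_Icc_right h1))
    (fun _ hx => hasDerivAt_kernel hr hk hx.1 (hx.2.le.trans h1))
    (fun _ hx => kernelDeriv_nonneg hr hk (hx.2.le.trans h1))

lemma setIntegral_kernelDeriv {r : ℝ} (hr : 0 < r) {k : ℕ} (hk : 1 ≤ k) {y : ℝ} (h0 : 0 ≤ y)
    (h1 : y ≤ 1) : ∫ u in Set.Ioc 0 y, kernelDeriv r k u = kernel r k y := by
  rw [← intervalIntegral.integral_of_le h0,
    intervalIntegral.integral_eq_sub_of_hasDerivAt_of_le h0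
      ((continuousOn_kernel hr hk).mono (Set.Icc_subset_Icc_right h1))
      (fun x hx => hasDerivAt_kernel hr hk hx.1 (hx.2.le.trans h1))
      ((intervalIntegrable_iff_integrableOn_Ioc_of_le h0).2 (integrableOn_kernelDeriv hr hk h1)),
    kernel_zero, sub_zero]

/-- The tail of the kernel at `1`. -/
lemma tendsto_one_sub_kernel_div {r : ℝ} (hr : 0 < r) {k : ℕ} (hk : 1 ≤ k) :
    Tendsto (fun y => (1 - kernel r k y) / (1 - y) ^ k) (𝓝[<] 1)
      (𝓝 (1 / ((k : ℝ) * ProbabilityTheory.beta r k))) := by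
  have hk0 : (0 : ℝ) < k := by exact_mod_cast hk
  have hmem : Set.Ioo (0 : ℝ) 1 ∈ 𝓝[<] (1 : ℝ) := Ioo_mem_nhdsLT zero_lt_one
  refine HasDerivAt.lhopital_zero_nhdsLT (f' := fun y => -kernelDeriv r k y)
    (g' := fun y => -(k * (1 - y) ^ (k - 1))) ?_ ?_ ?_ ?_ ?_ ?_
  · filter_upwards [hmem] with y hy
    exact (hasDerivAt_kernel hr hk hy.1 hy.2.le).const_sub 1
  · filter_upwards [hmem] with y hy
    refine (((hasDerivAt_id' y).const_sub 1).fun_pow k).congr_deriv ?_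
    ring
  · filter_upwards [hmem] with y hy
    have : 0 < 1 - y := by linarith [hy.2]
    exact neg_ne_zero.2 (by positivity)
  · have h := (hasDerivAt_kernel hr hk one_pos le_rfl).continuousAt.tendsto
    rw [kernel_one hk] at h
    simpa using (h.mono_left nhdsWithin_le_nhds).const_sub 1
  · have h : Continuous fun y : ℝ => (1 - y) ^ k := by fun_prop
    have h2 := (h.tendsto 1).mono_left (nhdsWithin_le_nhds (s := Set.Iio 1))
    simpa [show k ≠ 0 by omega] using h2
  -- The quotient of the derivatives is $(-\ln y/(1-y))^{k-1}$ times a function continuous at $1$;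
  -- the base is a slope of $\ln$ at $1$.
  · have hlog : Tendsto (fun y : ℝ => -Real.log y / (1 - y)) (𝓝[<] 1) (𝓝 1) := by
      have h := (Real.hasDerivAt_log one_ne_zero).tendsto_slope
      have h2 := h.mono_left (nhdsWithin_mono 1 (fun y (hy : y < 1) => hy.ne))
      rw [inv_one] at h2
      refine h2.congr fun y => ?_
      rw [slope_def_field, Real.log_one, sub_zero, ← neg_sub y 1, neg_div_neg_eq]
    have hc : ContinuousAt (fun y : ℝ => 1 / ProbabilityTheory.beta r k * (1 / y) /
        (1 - Real.log y) ^ (r + (k : ℝ)) / k) 1 := by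
      have : ContinuousAt (fun y : ℝ => 1 - Real.log y) 1 :=
        continuousAt_const.sub (Real.continuousAt_log one_ne_zero)
      refine ((continuousAt_const.mul (continuousAt_const.div continuousAt_id one_ne_zero)).div
        (this.rpow_const (by simp)) ?_).div_const _
      simp
    have hl := (hlog.pow (k - 1)).mul (hc.tendsto.mono_left (nhdsWithin_le_nhds (s := Set.Iio 1)))
    have hv : (1 : ℝ) ^ (k - 1) * (1 / ProbabilityTheory.beta r k * (1 / 1) /
        (1 - Real.log 1) ^ (r + (k : ℝ)) / k) = 1 / ((k : ℝ) * ProbabilityTheory.beta r k) := by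
      have := (beta_pos hr hk).ne'
      simp [div_eq_mul_inv]
    rw [hv] at hl
    refine hl.congr' ?_
    filter_upwards [hmem] with y hy
    have : 0 < 1 - y := by linarith [hy.2]
    rw [kernelDeriv, if_pos hy.1, neg_div_neg_eq, div_pow]
    field_simp

/-! ### Quantiles and the right endpoint of a continuous df. -/

section DistributionFunctions

variable {F : ℝ → ℝ}

lemma IsDF.nonneg (hF : IsDF F) (x : ℝ) : 0 ≤ F x := hF.mono.le_of_tendsto hF.atBot x

lemma IsDF.le_one (hF : IsDF F) (x : ℝ) : F x ≤ 1 := hF.mono.ge_of_tendsto hF.atTop x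

lemma HasDensity.continuous {f : ℝ → ℝ} (hf : HasDensity F f) : Continuous F := by
  have h : F = fun x => F 0 + ∫ t in (0 : ℝ)..x, f t := by
    ext x
    rw [← intervalIntegral.integral_Iic_sub_Iic hf.integrable.integrableOn
      hf.integrable.integrableOn, hf.eq_integral 0, ← hf.eq_integral x]
    ring
  rw [h]
  exact continuous_const.add (intervalIntegral.continuous_primitive
    (fun a b => hf.integrable.intervalIntegrable) 0)

lemma IsDF.bddBelow_le (hF : IsDF F) {y : ℝ} (h0 : 0 < y) : BddBelow {x | y ≤ F x} := by
  obtain ⟨b, hb⟩ := (hF.atBot.eventually_lt_const h0).exists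
  exact ⟨b, fun x hx => le_of_not_gt fun h => (hb.trans_le hx).not_ge (hF.mono h.le)⟩

lemma apply_genInv (hF : IsDF F) (hc : Continuous F) {y : ℝ} (h0 : 0 < y) (h1 : y < 1) :
    F (genInv F y) = y := by
  have hne : {x | y ≤ F x}.Nonempty :=
    let ⟨b, hb⟩ := (hF.atTop.eventually_const_lt h1).exists; ⟨b, le_of_lt hb⟩
  have hmem := (isClosed_le continuous_const hc).csInf_mem hne (hF.bddBelow_le h0)
  refine le_antisymm (le_of_not_gt fun h => ?_) hmem
  obtain ⟨x, hx, hx'⟩ := ((hc.continuousAt.eventually_const_lt h).filter_mono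
    (nhdsWithin_le_nhds (s := Set.Iio (genInv F y))) |>.and self_mem_nhdsWithin).exists
  exact (csInf_le (hF.bddBelow_le h0) hx.le).not_gt hx'

lemma coe_lt_rightEnd_iff (hF : IsDF F) (hc : Continuous F) (x : ℝ) :
    (x : EReal) < rightEnd F ↔ F x < 1 := by
  rw [rightEnd, lt_sSup_iff]
  constructor
  · rintro ⟨_, ⟨a, ha, rfl⟩, hx⟩
    exact (hF.mono (EReal.coe_lt_coe_iff.1 hx).le).trans_lt ha
  · intro h
    obtain ⟨y, hy, hy'⟩ := ((hc.continuousAt.eventually_lt_const h).filter_mono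
      (nhdsWithin_le_nhds (s := Set.Ioi x)) |>.and self_mem_nhdsWithin).exists
    exact ⟨y, ⟨y, hy, rfl⟩, EReal.coe_lt_coe_iff.2 hy'⟩

/-- Treats finite and infinite endpoints at once: a continuous df takes values in $(c,1)$ for every
$c<1$, so approaching $r(F)$ from the left means that $F$ approaches $1$ from below. -/
lemma toRightEnd_eq_comap (hF : IsDF F) (hc : Continuous F) :
    toRightEnd F = comap F (𝓝[<] 1) := by
  have hlt := coe_lt_rightEnd_iff hF hc
  have hval : ∀ c : ℝ, c < 1 → ∃ x, c < F x ∧ F x < 1 := fun c hc1 => by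
    have h0 : 0 < (max c 0 + 1) / 2 := by have := le_max_right c 0; linarith
    have h1 : (max c 0 + 1) / 2 < 1 := by have := max_lt hc1 one_pos; linarith
    refine ⟨genInv F ((max c 0 + 1) / 2), ?_, ?_⟩ <;> rw [apply_genInv hF hc h0 h1]
    · have := max_lt hc1 one_pos
      have := le_max_left c 0
      linarith
    · exact h1
  have hbot : ∃ b, b < rightEnd F :=
    let ⟨x, hx⟩ := hval 0 one_pos; ⟨x, (hlt x).2 hx.2⟩
  have hB := (nhdsLT_basis_of_exists_lt hbot).comap Real.toEReal
  have hB' := (nhdsLT_basis (1 : ℝ)).comap F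
  refine le_antisymm ((hB.le_basis_iff hB').2 fun c hc1 => ?_)
    ((hB'.le_basis_iff hB).2 fun b hb => ?_)
  · obtain ⟨x, hx, hx1⟩ := hval c hc1
    exact ⟨x, (hlt x).2 hx1, fun z hz => ⟨hx.trans_le (hF.mono (EReal.coe_lt_coe_iff.1 hz.1).le),
      (hlt z).1 hz.2⟩⟩
  · obtain ⟨_, ⟨a, ha, rfl⟩, hba⟩ := lt_sSup_iff.1 hb
    exact ⟨F a, ha, fun z hz => ⟨hba.trans (EReal.coe_lt_coe_iff.2 (hF.mono.reflect_lt hz.1)),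
      (hlt z).2 hz.2⟩⟩

lemma tendsto_toRightEnd_iff (hF : IsDF F) (hc : Continuous F) {ι : Type*} {l : Filter ι}
    {z : ι → ℝ} : Tendsto z l (toRightEnd F) ↔
      (∀ᶠ i in l, F (z i) < 1) ∧ Tendsto (fun i => F (z i)) l (𝓝 1) := by
  rw [toRightEnd_eq_comap hF hc, tendsto_comap_iff, tendsto_nhdsWithin_iff, and_comm]
  rfl

lemma tendsto_apply_toRightEnd (hF : IsDF F) (hc : Continuous F) :
    Tendsto F (toRightEnd F) (𝓝[<] 1) := by
  rw [toRightEnd_eq_comap hF hc]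
  exact tendsto_comap

end DistributionFunctions

/-! ### The probability integral transform and the density of $T_k$. -/

section ProbabilityIntegralTransform

variable {F f : ℝ → ℝ}

/-- The law with density `f`. -/
def lawOf (f : ℝ → ℝ) : Measure ℝ := volume.withDensity fun x => ENNReal.ofReal (f x)

lemma HasDensity.isFiniteMeasure (hf : HasDensity F f) : IsFiniteMeasure (lawOf f) :=
  isFiniteMeasure_withDensity_ofReal hf.integrable.2

lemma HasDensity.lawOf_Iic (hf : HasDensity F f) (x : ℝ) :
    lawOf f (Set.Iic x) = ENNReal.ofReal (F x) := by
  rw [lawOf, withDensity_apply _ measurableSet_Iic, hf.eq_integral,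
    ofReal_integral_eq_lintegral_ofReal hf.integrable.integrableOn
      (Eventually.of_forall hf.nonneg)]

/-- The probability integral transform. -/
lemma HasDensity.map_lawOf (hf : HasDensity F f) (hF : IsDF F) :
    (lawOf f).map F = volume.restrict (Set.Ioc 0 1) := by
  have hc := hf.continuous
  have := hf.isFiniteMeasure
  refine Measure.ext_of_Iic _ _ fun u => ?_
  rw [Measure.map_apply hc.measurable measurableSet_Iic,
    Measure.restrict_apply measurableSet_Iic, Set.inter_comm, Set.Ioc_inter_Iic,
    Real.volume_Ioc, sub_zero]
  rcases le_or_gt 1 u with h1 | h1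
  · have h2 : F ⁻¹' Set.Iic u = Set.univ :=
      Set.eq_univ_of_forall fun x => (hF.le_one x).trans h1
    have h3 : Tendsto (fun x => lawOf f (Set.Iic x)) atTop (𝓝 (lawOf f Set.univ)) :=
      tendsto_measure_Iic_atTop _
    have h4 : Tendsto (fun x => lawOf f (Set.Iic x)) atTop (𝓝 (ENNReal.ofReal 1)) := by
      simp_rw [hf.lawOf_Iic]
      exact ENNReal.tendsto_ofReal hF.atTop
    rw [h2, tendsto_nhds_unique h3 h4, min_eq_left h1]
  rw [min_eq_right h1.le]
  rcases Set.eq_empty_or_nonempty (F ⁻¹' Set.Iic u) with he | hne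
  · rw [he, measure_empty]
    refine (ENNReal.ofReal_of_nonpos (ge_of_tendsto' hF.atBot fun x => ?_)).symm
    exact le_of_not_ge fun h => (Set.eq_empty_iff_forall_notMem.1 he x) h
  · have hbdd : BddAbove (F ⁻¹' Set.Iic u) := by
      obtain ⟨b, hb⟩ := (hF.atTop.eventually_const_lt h1).exists
      exact ⟨b, fun x hx => le_of_not_gt fun h => (lt_of_le_of_lt hx hb).not_ge (hF.mono h.le)⟩
    have hmem : F (sSup (F ⁻¹' Set.Iic u)) ≤ u := (isClosed_Iic.preimage hc).csSup_mem hne hbdd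
    set s := sSup (F ⁻¹' Set.Iic u)
    have hset : F ⁻¹' Set.Iic u = Set.Iic s :=
      Set.Subset.antisymm (fun x hx => le_csSup hbdd hx) fun x hx => (hF.mono hx).trans hmem
    have hval : F s = u := by
      refine le_antisymm hmem (le_of_not_gt fun h => ?_)
      obtain ⟨x, hx, hx'⟩ := ((hc.continuousAt.eventually_lt_const h).filter_mono
        (nhdsWithin_le_nhds (s := Set.Ioi s)) |>.and self_mem_nhdsWithin).exists
      exact (le_csSup hbdd hx.le : x ≤ s).not_gt hx'
    rw [hset, hf.lawOf_Iic, hval]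

/-- The two sets differ by a stretch on which $F$ is flat; both have mass $F(x)$. -/
lemma HasDensity.Iic_ae_eq (hf : HasDensity F f) (hF : IsDF F) (x : ℝ) :
    Set.Iic x =ᵐ[lawOf f] F ⁻¹' Set.Iic (F x) := by
  have := hf.isFiniteMeasure
  refine ae_eq_of_subset_of_measure_ge (fun y hy => hF.mono hy) ?_
    measurableSet_Iic.nullMeasurableSet (measure_ne_top _ _)
  rw [← Measure.map_apply hf.continuous.measurable measurableSet_Iic, hf.map_lawOf hF,
    Measure.restrict_apply measurableSet_Iic, Set.inter_comm, Set.Ioc_inter_Iic,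
    Real.volume_Ioc, sub_zero,
    min_eq_right (hF.le_one x), hf.lawOf_Iic]

/-- Integrals of `kernelDeriv` composed with $F$ are pushed forward to the uniform law on $(0,1]$,
which avoids differentiating $F$. -/
lemma T_hasDensity (hF : IsDF F) (hf : HasDensity F f) {r : ℝ} (hr : 0 < r) {k : ℕ}
    (hk : 1 ≤ k) : HasDensity (T F r k) (tDensity F f r k) := by
  have hfm : AEMeasurable (fun x => ENNReal.ofReal (f x)) volume :=
    hf.integrable.aemeasurable.ennreal_ofReal
  have hg := (measurable_kernelDeriv r k).aestronglyMeasurable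
    (μ := (lawOf f).map F)
  have hFm : AEMeasurable F (lawOf f) := hf.continuous.aemeasurable
  have heq : tDensity F f r k =
      fun x => (ENNReal.ofReal (f x)).toReal • kernelDeriv r k (F x) := by
    ext x
    rw [tDensity_eq, ENNReal.toReal_ofReal (hf.nonneg x), smul_eq_mul]
  refine ⟨fun x => ?_, ?_, fun x => ?_⟩
  · rw [tDensity_eq]
    exact mul_nonneg (hf.nonneg x) (kernelDeriv_nonneg hr hk (hF.le_one x))
  · rw [heq, ← integrable_withDensity_iff_integrable_smul₀' hfm (by simp)]
    refine (integrable_map_measure hg hFm).1 ?_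
    rw [hf.map_lawOf hF]
    exact integrableOn_kernelDeriv hr hk le_rfl
  · rw [heq, ← setIntegral_withDensity_eq_setIntegral_toReal_smul₀ hfm.restrict (by simp) _
      measurableSet_Iic]
    change _ = ∫ x in Set.Iic x, kernelDeriv r k (F x) ∂(lawOf f)
    rw [setIntegral_congr_set (hf.Iic_ae_eq hF x),
      ← setIntegral_map measurableSet_Iic hg hFm, hf.map_lawOf hF,
      Measure.restrict_restrict measurableSet_Iic, Set.inter_comm, Set.Ioc_inter_Iic,
      min_eq_right (hF.le_one x),
      setIntegral_kernelDeriv hr hk (hF.nonneg x) (hF.le_one x), T_eq_kernel]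

end ProbabilityIntegralTransform

/-! ### The tail of $T_k$ at the right endpoint. -/

section TailOfT

variable {F : ℝ → ℝ} {r : ℝ} {k : ℕ}

lemma T_lt_one_iff (hF : IsDF F) (hr : 0 < r) (hk : 1 ≤ k) (x : ℝ) :
    T F r k x < 1 ↔ F x < 1 := by
  conv_lhs => rw [T_eq_kernel, ← kernel_one (r := r) hk]
  exact (strictMonoOn_kernel hr hk).lt_iff_lt ⟨hF.nonneg x, hF.le_one x⟩ ⟨zero_le_one, le_rfl⟩

lemma T_mono (hF : IsDF F) (hr : 0 < r) (hk : 1 ≤ k) : Monotone (T F r k) := fun x y hxy =>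
  (strictMonoOn_kernel hr hk).monotoneOn ⟨hF.nonneg x, hF.le_one x⟩ ⟨hF.nonneg y, hF.le_one y⟩
    (hF.mono hxy)

lemma T_continuous (hF : IsDF F) (hc : Continuous F) (hr : 0 < r) (hk : 1 ≤ k) :
    Continuous (T F r k) :=
  (continuousOn_kernel hr hk).comp_continuous hc fun x => ⟨hF.nonneg x, hF.le_one x⟩

lemma T_isDF (hF : IsDF F) (hc : Continuous F) (hr : 0 < r) (hk : 1 ≤ k) :
    IsDF (T F r k) := by
  have hlim : ∀ {l : Filter ℝ} {y : ℝ}, y ∈ Set.Icc (0 : ℝ) 1 → Tendsto F l (𝓝 y) →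
      Tendsto (T F r k) l (𝓝 (kernel r k y)) := fun hy h =>
    (continuousOn_kernel hr hk _ hy).tendsto.comp
      (tendsto_nhdsWithin_iff.2 ⟨h, Eventually.of_forall fun x => ⟨hF.nonneg x, hF.le_one x⟩⟩)
  refine ⟨T_mono hF hr hk, fun x => (T_continuous hF hc hr hk).continuousWithinAt, ?_, ?_⟩
  · simpa [kernel_zero] using hlim ⟨le_rfl, zero_le_one⟩ hF.atBot
  · simpa [kernel_one hk] using hlim ⟨zero_le_one, le_rfl⟩ hF.atTop

lemma rightEnd_T (hF : IsDF F) (hr : 0 < r) (hk : 1 ≤ k) :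
    rightEnd (T F r k) = rightEnd F := by
  simp only [rightEnd, T_lt_one_iff hF hr hk]

lemma rightEnd_H (hF : IsDF F) (hk : 1 ≤ k) : rightEnd (H F k) = rightEnd F := by
  have h : ∀ x, H F k x < 1 ↔ F x < 1 := fun x => by
    have h1 : 0 ≤ 1 - F x := sub_nonneg.2 (hF.le_one x)
    rw [H, sub_lt_self_iff, ← sub_pos (b := F x)]
    exact ⟨fun h => h1.lt_of_ne fun h0 => by simp [← h0, show k ≠ 0 by omega] at h,
      fun h => pow_pos h k⟩
  simp only [rightEnd, h]

lemma tendsto_one_sub_T_div (hF : IsDF F) (hc : Continuous F) (hr : 0 < r) (hk : 1 ≤ k) :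
    Tendsto (fun x => (1 - T F r k x) / (1 - F x) ^ k) (toRightEnd F)
      (𝓝 (1 / ((k : ℝ) * ProbabilityTheory.beta r k))) :=
  (tendsto_one_sub_kernel_div hr hk).comp (tendsto_apply_toRightEnd hF hc)

lemma T_tailEquivalent_H (hF : IsDF F) (hc : Continuous F) (hr : 0 < r) (hk : 1 ≤ k) :
    TailEquivalent (T F r k) (H F k) := by
  have hk0 : (0 : ℝ) < k := by exact_mod_cast hk
  have := beta_pos hr hk
  refine ⟨(rightEnd_T hF hr hk).trans (rightEnd_H hF hk).symm,
    1 / ((k : ℝ) * ProbabilityTheory.beta r k), by positivity, ?_⟩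
  have h : toRightEnd (H F k) = toRightEnd F := by simp only [toRightEnd, rightEnd_H hF hk]
  rw [h]
  simpa [H] using tendsto_one_sub_T_div hF hc hr hk

end TailOfT

/-! ### Limits of $n$-th powers and of $n$ times the tail. -/

section Powers

lemma tendsto_mul_one_sub_of_pow {y : ℕ → ℝ} (h0 : ∀ n, 0 ≤ y n) {c : ℝ}
    (h : Tendsto (fun n => y n ^ n) atTop (𝓝 (Real.exp (-c)))) :
    Tendsto (fun n : ℕ => (n : ℝ) * (1 - y n)) atTop (𝓝 c) := by
  have hpos : ∀ᶠ n in atTop, 0 < y n := by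
    filter_upwards [h.eventually_const_lt (Real.exp_pos _), eventually_ge_atTop 1] with n hn hn1
    refine (h0 n).lt_of_ne fun h => ?_
    rw [← h, zero_pow (by omega)] at hn
    exact hn.false
  have hlog : Tendsto (fun n : ℕ => (n : ℝ) * Real.log (y n)) atTop (𝓝 (-c)) := by
    have := (Real.continuousAt_log (Real.exp_pos (-c)).ne').tendsto.comp h
    simpa [Function.comp_def, Real.log_pow] using this
  have hlog0 : Tendsto (fun n : ℕ => Real.log (y n)) atTop (𝓝 0) := by
    have := hlog.mul tendsto_inv_atTop_nhds_zero_nat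
    rw [mul_zero] at this
    refine this.congr' ?_
    filter_upwards [eventually_ge_atTop 1] with n hn
    have : (0 : ℝ) < n := by exact_mod_cast hn
    field_simp
  -- $y-1=\ln y$ times the divided difference of $\exp$ between $0$ and $\ln y$; `dslope` also
  -- covers $\ln y=0$.
  have hs : Tendsto (fun n => dslope Real.exp 0 (Real.log (y n))) atTop (𝓝 1) := by
    have hc : ContinuousAt (dslope Real.exp 0) 0 :=
      continuousAt_dslope_same.2 Real.differentiableAt_exp
    simpa [ContinuousAt, dslope_same, Function.comp_def] using hc.tendsto.comp hlog0
  have := (hlog.mul hs).neg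
  rw [mul_one, neg_neg] at this
  refine this.congr' ?_
  filter_upwards [hpos] with n hn
  have h2 := sub_smul_dslope Real.exp 0 (Real.log (y n))
  rw [sub_zero, smul_eq_mul, Real.exp_zero, Real.exp_log hn] at h2
  rw [mul_assoc, h2]
  ring

lemma tendsto_pow_of_mul_one_sub {y : ℕ → ℝ} {c : ℝ}
    (h : Tendsto (fun n : ℕ => (n : ℝ) * (1 - y n)) atTop (𝓝 c)) :
    Tendsto (fun n => y n ^ n) atTop (𝓝 (Real.exp (-c))) := by
  have h2 : Tendsto (fun n : ℕ => (n : ℝ) * (y n - 1)) atTop (𝓝 (-c)) :=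
    h.neg.congr fun n => by ring
  simpa using Real.tendsto_one_add_pow_exp_of_tendsto h2

end Powers

/-- If `u n ≤ e n + q * u (n / 2)` with `e n → 0` and `q < 1`, then `u n → 0`. -/
lemma tendsto_zero_of_le_add_mul_half {u e : ℕ → ℝ} {q : ℝ} (hu : ∀ᶠ n in atTop, 0 ≤ u n)
    (he : Tendsto e atTop (𝓝 0)) (hq0 : 0 ≤ q) (hq1 : q < 1)
    (h : ∀ᶠ n in atTop, u n ≤ e n + q * u (n / 2)) : Tendsto u atTop (𝓝 0) := by
  refine tendsto_order.2 ⟨fun c hc => hu.mono fun n hn => hc.trans_le hn, fun ε hε => ?_⟩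
  -- This bound on $e_n$ makes $\varepsilon/2$ the fixed point of $u\mapsto\delta+qu$, so the excess
  -- over $\varepsilon/2$ contracts by $q$ at each halving.
  have hδ : 0 < ε / 2 * (1 - q) := mul_pos (by linarith) (by linarith)
  obtain ⟨N, hN⟩ := eventually_atTop.1 (h.and (he.eventually_lt_const hδ))
  obtain ⟨C, hC⟩ := ((Set.finite_Iio (N + 1)).image fun n => u n - ε / 2).bddAbove
  have hstep : ∀ n, N + 1 ≤ n → u n - ε / 2 ≤ q * (u (n / 2) - ε / 2) := fun n hn => by
    have := hN n (by omega)
    nlinarith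
  have hbd : ∀ n, u n - ε / 2 ≤ max C 0 := by
    intro n
    induction n using Nat.strong_induction_on with
    | _ n ih =>
      rcases lt_or_ge n (N + 1) with hn | hn
      · exact (hC ⟨n, hn, rfl⟩).trans (le_max_left _ _)
      · refine (hstep n hn).trans ((mul_le_mul_of_nonneg_left (ih (n / 2) (by omega)) hq0).trans ?_)
        exact mul_le_of_le_one_left (le_max_right _ _) hq1.le
  have hpow : ∀ j n, (N + 1) * 2 ^ j ≤ n → u n - ε / 2 ≤ q ^ j * max C 0 := by
    intro j
    induction j with
    | zero => intro n _; simpa using hbd n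
    | succ j ih =>
      intro n hn
      rw [pow_succ, ← mul_assoc] at hn
      have h1 : N + 1 ≤ (N + 1) * 2 ^ j := Nat.le_mul_of_pos_right _ (by positivity)
      refine (hstep n (by omega)).trans ?_
      rw [pow_succ', mul_assoc]
      exact mul_le_mul_of_nonneg_left (ih (n / 2) (by omega)) hq0
  have hlim := (tendsto_pow_atTop_nhds_zero_of_lt_one hq0 hq1).mul_const (max C 0)
  rw [zero_mul] at hlim
  obtain ⟨j, hj⟩ := (hlim.eventually_lt_const (half_pos hε)).exists
  filter_upwards [eventually_ge_atTop ((N + 1) * 2 ^ j)] with n hn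
  have := hpow j n hn
  linarith

/-! ### Scaled tails and convergence of types. -/

section Scaling

variable {ι : Type*} {l : Filter ι}

/-- The tail of `F` at `a i * x + b i`, on the scale `p i`, converges to `φ x` for `x ∈ I`. -/
def ScaledTail (F φ : ℝ → ℝ) (I : Set ℝ) (l : Filter ι) (p a b : ι → ℝ) : Prop :=
  (∀ᶠ i in l, 0 < a i) ∧
    ∀ x ∈ I, Tendsto (fun i => (1 - F (a i * x + b i)) / p i) l (𝓝 (φ x))

variable {F φ : ℝ → ℝ} {I : Set ℝ} {p a b : ι → ℝ}

lemma antitone_tail_div (hF : Monotone F) {p : ℝ} (hp : 0 < p) :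
    Antitone fun x => (1 - F x) / p := fun x y hxy => by
  have := hF hxy
  dsimp only
  gcongr

/-- Points where the scaled tail tends to `φ y` are asymptotically `a i * y + b i`. -/
lemma ScaledTail.tendsto_point (h : ScaledTail F φ I l p a b) (hF : Monotone F)
    (hp : ∀ᶠ i in l, 0 < p i) (hI : IsOpen I) (hφ : StrictAntiOn φ I) {y : ℝ} (hy : y ∈ I)
    {z : ι → ℝ} (hz : Tendsto (fun i => (1 - F (z i)) / p i) l (𝓝 (φ y))) :
    Tendsto (fun i => (z i - b i) / a i) l (𝓝 y) := by
  refine tendsto_order.2 ⟨fun c hc => ?_, fun c hc => ?_⟩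
  · obtain ⟨x, ⟨hcx, hxI⟩, hxy⟩ := (((lt_mem_nhds hc).and (hI.mem_nhds hy)).filter_mono
      (nhdsWithin_le_nhds (s := Set.Iio y)) |>.and self_mem_nhdsWithin).exists
    filter_upwards [hz.eventually_lt (h.2 x hxI) (hφ hxI hy hxy), hp, h.1] with i hi hpi hai
    have hlt : a i * x + b i < z i := (antitone_tail_div hF hpi).reflect_lt hi
    rw [lt_div_iff₀ hai]
    nlinarith
  · obtain ⟨x, ⟨hcx, hxI⟩, hxy⟩ := (((gt_mem_nhds hc).and (hI.mem_nhds hy)).filter_mono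
      (nhdsWithin_le_nhds (s := Set.Ioi y)) |>.and self_mem_nhdsWithin).exists
    filter_upwards [(h.2 x hxI).eventually_lt hz (hφ hy hxI hxy), hp, h.1] with i hi hpi hai
    have hlt : z i < a i * x + b i := (antitone_tail_div hF hpi).reflect_lt hi
    rw [div_lt_iff₀ hai]
    nlinarith

/-- The scaled tail at points that are asymptotically `a i * y + b i`. -/
lemma ScaledTail.tendsto_of_point (h : ScaledTail F φ I l p a b) (hF : Monotone F)
    (hp : ∀ᶠ i in l, 0 < p i) (hI : IsOpen I) {y : ℝ} (hy : y ∈ I) (hφ : ContinuousAt φ y)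
    {z : ι → ℝ} (hz : Tendsto (fun i => (z i - b i) / a i) l (𝓝 y)) :
    Tendsto (fun i => (1 - F (z i)) / p i) l (𝓝 (φ y)) := by
  refine tendsto_order.2 ⟨fun c hc => ?_, fun c hc => ?_⟩
  · obtain ⟨x, ⟨hcx, hxI⟩, hxy⟩ := (((hφ.eventually_const_lt hc).and (hI.mem_nhds hy)).filter_mono
      (nhdsWithin_le_nhds (s := Set.Ioi y)) |>.and self_mem_nhdsWithin).exists
    filter_upwards [(h.2 x hxI).eventually_const_lt hcx, hz.eventually_lt_const hxy, hp, h.1]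
      with i hi hzi hpi hai
    rw [div_lt_iff₀ hai] at hzi
    exact hi.trans_le (antitone_tail_div hF hpi (by linarith))
  · obtain ⟨x, ⟨hcx, hxI⟩, hxy⟩ := (((hφ.eventually_lt_const hc).and (hI.mem_nhds hy)).filter_mono
      (nhdsWithin_le_nhds (s := Set.Iio y)) |>.and self_mem_nhdsWithin).exists
    filter_upwards [(h.2 x hxI).eventually_lt_const hcx, hz.eventually_const_lt hxy, hp, h.1]
      with i hi hzi hpi hai
    rw [lt_div_iff₀ hai] at hzi
    exact (antitone_tail_div hF hpi (by linarith)).trans_lt hi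

lemma ScaledTail.comp (h : ScaledTail F φ I l p a b) {κ : Type*} {l' : Filter κ} {m : κ → ι}
    (hm : Tendsto m l' l) :
    ScaledTail F φ I l' (fun i => p (m i)) (fun i => a (m i)) (fun i => b (m i)) :=
  ⟨hm.eventually h.1, fun x hx => (h.2 x hx).comp hm⟩

lemma ScaledTail.rescale (h : ScaledTail F φ I l p a b) (hp : ∀ᶠ i in l, 0 < p i) {p' : ι → ℝ}
    {c : ℝ} (hp' : Tendsto (fun i => p i / p' i) l (𝓝 c)) :
    ScaledTail F (fun x => c * φ x) I l p' a b := by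
  refine ⟨h.1, fun x hx => (hp'.mul (h.2 x hx)).congr' ?_⟩
  filter_upwards [hp] with i hi
  field_simp

lemma ScaledTail.congr_shift (h : ScaledTail F φ I l p a b) (hF : Monotone F)
    (hp : ∀ᶠ i in l, 0 < p i) (hI : IsOpen I) (hφ : ContinuousOn φ I) {b' : ι → ℝ}
    (hb : Tendsto (fun i => (b' i - b i) / a i) l (𝓝 0)) : ScaledTail F φ I l p a b' := by
  refine ⟨h.1, fun x hx => h.tendsto_of_point hF hp hI hx (hφ.continuousAt (hI.mem_nhds hx)) ?_⟩
  have := hb.const_add x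
  rw [add_zero] at this
  refine this.congr' ?_
  filter_upwards [h.1] with i hi
  field_simp
  ring

lemma MaxConverges.scaledTail {G : ℝ → ℝ} {a b : ℕ → ℝ} (h : MaxConverges F G a b)
    (h0 : ∀ x, 0 ≤ F x) (hG : ∀ x ∈ I, ContinuousAt G x ∧ G x = Real.exp (-φ x)) :
    ScaledTail F φ I atTop (fun n : ℕ => 1 / (n : ℝ)) a b := by
  refine ⟨h.1, fun x hx => ?_⟩
  have h2 := h.2 x (hG x hx).1
  rw [(hG x hx).2] at h2
  refine (tendsto_mul_one_sub_of_pow (fun n => h0 _) h2).congr fun n => ?_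
  rw [div_div_eq_mul_div, div_one, mul_comm]

lemma eventually_one_div_natCast_pos : ∀ᶠ n : ℕ in atTop, (0 : ℝ) < 1 / (n : ℝ) := by
  filter_upwards [eventually_ge_atTop 1] with n hn
  have : (0 : ℝ) < n := by exact_mod_cast hn
  positivity

/-- Convergence along the integers gives convergence along every scale `p → 0+`. -/
lemma ScaledTail.of_nat {a b : ℕ → ℝ} (h : ScaledTail F φ I atTop (fun n : ℕ => 1 / (n : ℝ)) a b)
    (hp : ∀ᶠ i in l, 0 < p i) (hp0 : Tendsto p l (𝓝 0)) :
    ScaledTail F φ I l p (fun i => a ⌊(p i)⁻¹⌋₊) (fun i => b ⌊(p i)⁻¹⌋₊) := by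
  have hinv : Tendsto (fun i => (p i)⁻¹) l atTop :=
    tendsto_inv_nhdsGT_zero.comp (tendsto_nhdsWithin_iff.2 ⟨hp0, hp⟩)
  have hm : Tendsto (fun i => ⌊(p i)⁻¹⌋₊) l atTop := tendsto_nat_floor_atTop.comp hinv
  have hlim : Tendsto (fun i => 1 / (⌊(p i)⁻¹⌋₊ : ℝ) / p i) l (𝓝 1) := by
    have := ((tendsto_nat_floor_div_atTop (R := ℝ)).comp hinv).inv₀ one_ne_zero
    rw [inv_one] at this
    refine this.congr fun i => ?_
    simp only [Function.comp_apply, inv_div]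
    rw [div_eq_mul_inv, div_div, one_div, mul_inv, mul_comm]
  simpa using (h.comp hm).rescale (hm.eventually eventually_one_div_natCast_pos) hlim

/-- Convergence of types for `n` against `n / 2`, if doubling `φ` amounts to a dilation by `θ`. -/
lemma ScaledTail.half {a b : ℕ → ℝ} (h : ScaledTail F φ I atTop (fun n : ℕ => 1 / (n : ℝ)) a b)
    (hF : Monotone F) (hI : IsOpen I) (hφ : StrictAntiOn φ I) {θ : ℝ}
    (hθ : ∀ x ∈ I, θ * x ∈ I ∧ 2 * φ x = φ (θ * x)) {y : ℝ} (hy0 : y ≠ 0) (hy : y ∈ I)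
    (hy2 : 2 * y ∈ I) :
    Tendsto (fun n => a (n / 2) / a n) atTop (𝓝 θ) ∧
      Tendsto (fun n => (b (n / 2) - b n) / a n) atTop (𝓝 0) := by
  have hm : Tendsto (fun n : ℕ => n / 2) atTop atTop := Nat.tendsto_div_const_atTop two_ne_zero
  have hlim : Tendsto (fun n : ℕ => 1 / ((n / 2 : ℕ) : ℝ) / (1 / (n : ℝ))) atTop (𝓝 2) := by
    have h1 := ((tendsto_nat_floor_div_atTop (R := ℝ)).comp
      ((tendsto_natCast_atTop_atTop (R := ℝ)).atTop_div_const two_pos)).inv₀ one_ne_zero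
    have h2 := h1.mul_const 2
    rw [inv_one, one_mul] at h2
    refine h2.congr fun n => ?_
    have h3 : ⌊(n : ℝ) / 2⌋₊ = n / 2 := by
      simpa using Nat.floor_div_natCast (K := ℝ) (n : ℝ) 2
    simp only [Function.comp_apply, inv_div, h3]
    field_simp
  have h2 := (h.comp hm).rescale (hm.eventually eventually_one_div_natCast_pos) hlim
  -- On the scale $1/n$ the tail at index $n/2$ tends to $2\varphi(x)=\varphi(\theta x)$, which
  -- locates the point. The two points $y$ and $2y$ then determine slope and intercept.
  have key : ∀ x ∈ I,
      Tendsto (fun n => (a (n / 2) * x + b (n / 2) - b n) / a n) atTop (𝓝 (θ * x)) := fun x hx => by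
    have h3 := h2.2 x hx
    dsimp only at h3
    rw [(hθ x hx).2] at h3
    exact h.tendsto_point hF eventually_one_div_natCast_pos hI hφ (hθ x hx).1 h3
  have k1 := key y hy
  have k2 := key (2 * y) hy2
  constructor
  · have := (k2.sub k1).div_const y
    rw [show (θ * (2 * y) - θ * y) / y = θ by field_simp; ring] at this
    refine this.congr fun n => ?_
    field_simp
    ring
  · have := (k1.const_mul 2).sub k2
    rw [show 2 * (θ * y) - θ * (2 * y) = 0 by ring] at this
    exact this.congr fun n => by ring

end Scaling

/-! ### From tails of $F$ to powers of $T_k$. -/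

section Transfer

variable {F : ℝ → ℝ} {r : ℝ} {k : ℕ}

/-- Transfer of scaled tails from `F` to powers of `T`. -/
lemma tendsto_T_pow (hF : IsDF F) (hc : Continuous F) (hr : 0 < r) (hk : 1 ≤ k) {p z : ℕ → ℝ}
    (hp : ∀ᶠ n in atTop, 0 < p n) (hp0 : Tendsto p atTop (𝓝 0))
    (hpk : Tendsto (fun n : ℕ => (n : ℝ) * p n ^ k) atTop
      (𝓝 ((k : ℝ) * ProbabilityTheory.beta r k))) {L : ℝ} (hL : 0 < L)
    (hz : Tendsto (fun n => (1 - F (z n)) / p n) atTop (𝓝 L)) :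
    Tendsto (fun n => T F r k (z n) ^ n) atTop (𝓝 (Real.exp (-L ^ k))) := by
  have hk0 : (0 : ℝ) < k := by exact_mod_cast hk
  have hB := beta_pos hr hk
  have hpos : ∀ᶠ n in atTop, 0 < 1 - F (z n) := by
    filter_upwards [hz.eventually_const_lt hL, hp] with n hn hpn
    simpa [hpn.ne'] using mul_pos hn hpn
  have hone : Tendsto (fun n => F (z n)) atTop (𝓝 1) := by
    have := (hz.mul hp0).const_sub 1
    rw [mul_zero, sub_zero] at this
    refine this.congr' ?_
    filter_upwards [hp] with n hn
    field_simp
    ring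
  have hzr : Tendsto z atTop (toRightEnd F) :=
    (tendsto_toRightEnd_iff hF hc).2 ⟨hpos.mono fun n hn => sub_pos.1 hn, hone⟩
  refine tendsto_pow_of_mul_one_sub ?_
  -- $n(1-T_k)=\frac{1-T_k}{(1-F)^k}\cdot\left(\frac{1-F}{p_n}\right)^k\cdot np_n^k$ at $z_n$.
  have h := (((tendsto_one_sub_T_div hF hc hr hk).comp hzr).mul (hz.pow k)).mul hpk
  have hv : 1 / ((k : ℝ) * ProbabilityTheory.beta r k) * L ^ k *
      ((k : ℝ) * ProbabilityTheory.beta r k) = L ^ k := by field_simp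
  rw [hv] at h
  refine h.congr' ?_
  filter_upwards [hp, hpos] with n hn hn'
  simp only [Function.comp_apply, div_pow]
  field_simp

end Transfer

section Domains

variable {F : ℝ → ℝ} {r : ℝ} {k : ℕ}

lemma tendsto_scale_pow (hr : 0 < r) (hk : 1 ≤ k) :
    (∀ᶠ n : ℕ in atTop,
      0 < ((k : ℝ) * ProbabilityTheory.beta r k / (n : ℝ)) ^ (1 / (k : ℝ))) ∧
    Tendsto (fun n : ℕ => ((k : ℝ) * ProbabilityTheory.beta r k / (n : ℝ)) ^ (1 / (k : ℝ)))
      atTop (𝓝 0) ∧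
    Tendsto (fun n : ℕ => (n : ℝ) *
        (((k : ℝ) * ProbabilityTheory.beta r k / (n : ℝ)) ^ (1 / (k : ℝ))) ^ k) atTop
      (𝓝 ((k : ℝ) * ProbabilityTheory.beta r k)) := by
  have hk0 : (0 : ℝ) < k := by exact_mod_cast hk
  have hB := beta_pos hr hk
  refine ⟨?_, ?_, ?_⟩
  · filter_upwards [eventually_ge_atTop 1] with n hn
    have : (0 : ℝ) < n := by exact_mod_cast hn
    positivity
  · have h := (tendsto_const_div_atTop_nhds_zero_nat
      ((k : ℝ) * ProbabilityTheory.beta r k)).rpow_const (p := 1 / (k : ℝ))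
        (Or.inr (by positivity))
    rwa [Real.zero_rpow (by positivity)] at h
  · refine tendsto_const_nhds.congr' ?_
    filter_upwards [eventually_ge_atTop 1] with n hn
    have : (0 : ℝ) < n := by exact_mod_cast hn
    rw [← Real.rpow_mul_natCast (by positivity), one_div_mul_cancel hk0.ne', Real.rpow_one]
    field_simp

/-- The quantiles at level `1 - p` have the scaled tail `1` on the scale `p`. -/
lemma tendsto_tail_genInv (hF : IsDF F) (hc : Continuous F) {ι : Type*} {l : Filter ι}
    {p : ι → ℝ} (hp : ∀ᶠ i in l, 0 < p i) (hp0 : Tendsto p l (𝓝 0)) :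
    Tendsto (fun i => (1 - F (genInv F (1 - p i))) / p i) l (𝓝 1) := by
  refine tendsto_const_nhds.congr' ?_
  filter_upwards [hp, hp0.eventually_lt_const one_pos] with i hi hi1
  rw [apply_genInv hF hc (by linarith) (by linarith)]
  field_simp
  ring

/-! ### The Fréchet domain. -/

section Frechet

variable {α : ℝ}

lemma continuousAt_frechet {x : ℝ} (hx : 0 < x) :
    ContinuousAt (frechet α) x ∧ frechet α x = Real.exp (-x ^ (-α)) := by
  refine ⟨?_, if_pos hx⟩
  have h : ContinuousAt (fun x : ℝ => Real.exp (-x ^ (-α))) x :=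
    (continuousAt_id.rpow_const (Or.inl hx.ne')).neg.rexp
  refine h.congr ?_
  filter_upwards [lt_mem_nhds hx] with y hy
  exact (if_pos hy).symm

lemma strictAntiOn_rpow_neg (hα : 0 < α) :
    StrictAntiOn (fun x : ℝ => x ^ (-α)) (Set.Ioi 0) := fun _ hx _ _ hxy =>
  Real.rpow_lt_rpow_of_neg hx hxy (neg_lt_zero.2 hα)

lemma continuousOn_rpow_neg : ContinuousOn (fun x : ℝ => x ^ (-α)) (Set.Ioi 0) := fun _ hx =>
  (continuousAt_id.rpow_const (Or.inl (ne_of_gt hx))).continuousWithinAt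

/-- In the Fréchet domain the centering constants may be dropped, and the scale is unbounded. -/
lemma frechet_scaledTail (hF : IsDF F) (hα : 0 < α) (h : InMaxDomain F (frechet α)) :
    ∃ a : ℕ → ℝ, Tendsto a atTop atTop ∧
      ScaledTail F (fun x => x ^ (-α)) (Set.Ioi 0) atTop (fun n : ℕ => 1 / (n : ℝ)) a
        (fun _ => 0) := by
  obtain ⟨a, b, hab⟩ := h
  have hs := hab.scaledTail (φ := fun x => x ^ (-α)) (I := Set.Ioi 0) hF.nonneg
    fun x hx => continuousAt_frechet hx
  -- Solves $2x^{-\alpha}=(\theta x)^{-\alpha}$. As $\theta<1$, eventually $a_{n/2}\le q\,a_n$ for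
  -- some $q<1$, so both $1/a_n$ and $|b_n|/a_n$ contract under halving.
  set θ : ℝ := 2 ^ (-α⁻¹) with hθdef
  have hθ0 : 0 < θ := by positivity
  have hθ1 : θ < 1 := Real.rpow_lt_one_of_one_lt_of_neg one_lt_two (by simpa using hα)
  obtain ⟨hratio, hshift⟩ := hs.half (θ := θ) (y := 1) hF.mono isOpen_Ioi
    (strictAntiOn_rpow_neg hα) (fun x (hx : 0 < x) => ⟨mul_pos hθ0 hx, by
      rw [Real.mul_rpow hθ0.le hx.le, hθdef, ← Real.rpow_mul two_pos.le, neg_mul_neg,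
        inv_mul_cancel₀ hα.ne', Real.rpow_one]⟩) one_ne_zero (by simp) (by simp)
  have hm : Tendsto (fun n : ℕ => n / 2) atTop atTop := Nat.tendsto_div_const_atTop two_ne_zero
  obtain ⟨q, hθq, hq1⟩ := exists_between hθ1
  have hq0 : 0 < q := hθ0.trans hθq
  have hstep : ∀ᶠ n in atTop, 0 < a n ∧ 0 < a (n / 2) ∧ a (n / 2) ≤ q * a n := by
    filter_upwards [hs.1, hm.eventually hs.1, hratio.eventually_lt_const hθq] with n h1 h2 h3
    exact ⟨h1, h2, ((div_lt_iff₀ h1).1 h3).le⟩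
  have hinv : Tendsto (fun n => (a n)⁻¹) atTop (𝓝 0) := by
    refine tendsto_zero_of_le_add_mul_half (e := fun _ => 0) (hs.1.mono fun n hn => by positivity)
      tendsto_const_nhds hq0.le hq1 ?_
    filter_upwards [hstep] with n hn
    obtain ⟨h1, h2, h3⟩ := hn
    rw [zero_add, ← div_eq_mul_inv, inv_eq_one_div, div_le_div_iff₀ h1 h2]
    linarith
  have hb : Tendsto (fun n => |b n| / a n) atTop (𝓝 0) := by
    refine tendsto_zero_of_le_add_mul_half (e := fun n => |(b (n / 2) - b n) / a n|)
      (hs.1.mono fun n hn => by positivity) (by simpa using hshift.abs) hq0.le hq1 ?_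
    filter_upwards [hstep] with n hn
    obtain ⟨h1, h2, h3⟩ := hn
    have h4 : |b n| ≤ |b (n / 2) - b n| + |b (n / 2)| := by
      have := abs_sub_abs_le_abs_sub (b n) (b (n / 2))
      rw [abs_sub_comm] at this
      linarith
    have h5 : |b (n / 2)| / a n ≤ q * (|b (n / 2)| / a (n / 2)) := by
      rw [← mul_div_assoc, div_le_div_iff₀ h1 h2]
      nlinarith [abs_nonneg (b (n / 2))]
    rw [abs_div, abs_of_pos h1]
    refine le_trans ?_ (add_le_add le_rfl h5)
    rw [← add_div]
    gcongr
  refine ⟨a, ?_, hs.congr_shift hF.mono eventually_one_div_natCast_pos isOpen_Ioi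
    continuousOn_rpow_neg ?_⟩
  · have := tendsto_inv_nhdsGT_zero.comp
      (tendsto_nhdsWithin_iff.2 ⟨hinv, hs.1.mono fun n hn => inv_pos.2 hn⟩)
    simpa [Function.comp_def] using this
  · rw [tendsto_zero_iff_abs_tendsto_zero]
    refine hb.congr' ?_
    filter_upwards [hs.1] with n hn
    simp [abs_div, abs_of_pos hn]

lemma frechet_rightEnd (hF : IsDF F) (hc : Continuous F) (hα : 0 < α)
    (h : InMaxDomain F (frechet α)) : rightEnd F = ⊤ := by
  obtain ⟨a, ha, hs⟩ := frechet_scaledTail hF hα h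
  refine EReal.eq_top_iff_forall_lt _ |>.2 fun x => (coe_lt_rightEnd_iff hF hc x).2 ?_
  have h1 := hs.2 1 (by simp)
  obtain ⟨n, hn, hn', hx⟩ := ((h1.eventually_const_lt (by simp : (0 : ℝ) < 1 ^ (-α))).and
    (eventually_one_div_natCast_pos.and (ha.eventually_ge_atTop x))).exists
  rw [div_pos_iff_of_pos_right hn'] at hn
  exact (hF.mono hx).trans_lt (by simpa using hn)

lemma T_maxConverges_frechet (hF : IsDF F) (hc : Continuous F) (hr : 0 < r) (hk : 1 ≤ k)
    (hα : 0 < α) (h : InMaxDomain F (frechet α)) :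
    MaxConverges (T F r k) (frechet (k * α))
      (fun n => genInv F (1 - ((k : ℝ) * ProbabilityTheory.beta r k / (n : ℝ)) ^ (1 / (k : ℝ))))
      (fun _ => 0) := by
  have hk0 : (0 : ℝ) < k := by exact_mod_cast hk
  obtain ⟨a, -, hs⟩ := frechet_scaledTail hF hα h
  obtain ⟨hp, hp0, hpk⟩ := tendsto_scale_pow hr hk
  have hs' := hs.of_nat hp hp0
  set A := fun n : ℕ => genInv F
    (1 - ((k : ℝ) * ProbabilityTheory.beta r k / (n : ℝ)) ^ (1 / (k : ℝ)))
  have hq := tendsto_tail_genInv hF hc hp hp0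
  change Tendsto (fun n => (1 - F (A n)) / _) _ _ at hq
  -- The quantile has scaled tail $1=\varphi(1)$, so it is asymptotic to the scale of `hs'`.
  have hA := hs'.tendsto_point (z := A) (y := 1) hF.mono hp isOpen_Ioi
    (strictAntiOn_rpow_neg hα) (by simp) (by simpa using hq)
  have hApos : ∀ᶠ n in atTop, 0 < A n := by
    filter_upwards [hA.eventually_const_lt one_pos, hs'.1] with n hn hn'
    rwa [sub_zero, div_pos_iff_of_pos_right hn'] at hn
  have hlim : ∀ x : ℝ, 0 < x →
      Tendsto (fun n => T F r k (A n * x) ^ n) atTop (𝓝 (frechet (k * α) x)) := fun x hx => by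
    have h1 := hs'.tendsto_of_point (z := fun n => A n * x) hF.mono hp isOpen_Ioi hx
      (continuousOn_rpow_neg.continuousAt (Ioi_mem_nhds hx)) (by
        have := hA.mul_const x
        rw [one_mul] at this
        exact this.congr fun n => by ring)
    have h2 := tendsto_T_pow hF hc hr hk hp hp0 hpk (by positivity) h1
    rwa [← Real.rpow_mul_natCast hx.le, mul_comm, mul_neg, ← (continuousAt_frechet hx).2] at h2
  refine ⟨hApos, fun x _ => ?_⟩
  simp only [add_zero]
  rcases lt_or_ge 0 x with hx | hx
  · exact hlim x hx
  have hT := T_isDF hF hc hr hk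
  rw [frechet, if_neg hx.not_gt]
  refine tendsto_order.2 ⟨fun c hc0 => Eventually.of_forall fun n =>
    hc0.trans_le (pow_nonneg (hT.nonneg _) n), fun c hc0 => ?_⟩
  have h0 : Tendsto (frechet (k * α)) (𝓝[>] 0) (𝓝 0) := by
    have h1 : Tendsto (fun y : ℝ => y ^ (-(k * α))) (𝓝[>] 0) atTop :=
      tendsto_rpow_neg_nhdsGT_zero (by nlinarith)
    refine (Real.tendsto_exp_neg_atTop_nhds_zero.comp h1).congr' ?_
    filter_upwards [self_mem_nhdsWithin] with y hy
    exact (if_pos hy).symm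
  -- For $x\le0$, monotonicity bounds the power by its value at a small $\varepsilon>0$, where the
  -- limit law is already below `c`.
  obtain ⟨ε, hε, hε0⟩ := ((h0.eventually_lt_const hc0).and self_mem_nhdsWithin).exists
  filter_upwards [(hlim ε hε0).eventually_lt_const hε, hApos] with n hn hAn
  refine lt_of_le_of_lt (pow_le_pow_left₀ (hT.nonneg _) (hT.mono ?_) n) hn
  have : (0 : ℝ) < ε := hε0
  nlinarith

end Frechet

/-! ### The Weibull domain. -/

section Weibull

variable {α : ℝ}

lemma continuousAt_weibull {x : ℝ} (hx : x < 0) :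
    ContinuousAt (weibull α) x ∧ weibull α x = Real.exp (-|x| ^ α) := by
  refine ⟨?_, if_pos hx⟩
  have h : ContinuousAt (fun x : ℝ => Real.exp (-|x| ^ α)) x :=
    (continuous_abs.continuousAt.rpow_const (Or.inl (abs_pos.2 hx.ne).ne')).neg.rexp
  refine h.congr ?_
  filter_upwards [gt_mem_nhds hx] with y hy
  exact (if_pos hy).symm

lemma strictAntiOn_abs_rpow (hα : 0 < α) :
    StrictAntiOn (fun x : ℝ => |x| ^ α) (Set.Iio 0) := fun x hx y hy hxy => by
  have hx' : x < 0 := hx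
  have hy' : y < 0 := hy
  refine Real.rpow_lt_rpow (abs_nonneg y) ?_ hα
  rw [abs_of_neg hx', abs_of_neg hy']
  linarith

lemma continuousOn_abs_rpow : ContinuousOn (fun x : ℝ => |x| ^ α) (Set.Iio 0) := fun _ hx =>
  (continuous_abs.continuousAt.rpow_const
    (Or.inl (abs_pos.2 (ne_of_lt hx)).ne')).continuousWithinAt

/-- In the Weibull domain the right extremity is finite, and it may serve as centering constant. -/
lemma weibull_scaledTail (hF : IsDF F) (hc : Continuous F) (hα : 0 < α)
    (h : InMaxDomain F (weibull α)) :
    ∃ ρ : ℝ, rightEnd F = ρ ∧ ∃ a : ℕ → ℝ,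
      ScaledTail F (fun x => |x| ^ α) (Set.Iio 0) atTop (fun n : ℕ => 1 / (n : ℝ)) a
        (fun _ => ρ) := by
  obtain ⟨a, b, hab⟩ := h
  have hs := hab.scaledTail (φ := fun x => |x| ^ α) (I := Set.Iio 0) hF.nonneg
    fun x hx => continuousAt_weibull hx
  -- Solves $2|x|^\alpha=|\theta x|^\alpha$. As $\theta>1$, the scales decay geometrically along
  -- $n,2n,4n,\dots$
  set θ : ℝ := 2 ^ α⁻¹ with hθdef
  have hθ0 : 0 < θ := by positivity
  have hθ1 : 1 < θ := Real.one_lt_rpow one_lt_two (by positivity)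
  obtain ⟨hratio, hshift⟩ := hs.half (θ := θ) (y := -1) hF.mono isOpen_Iio
    (strictAntiOn_abs_rpow hα) (fun x (hx : x < 0) => ⟨mul_neg_of_pos_of_neg hθ0 hx, by
      rw [abs_mul, Real.mul_rpow (abs_nonneg _) (abs_nonneg _), abs_of_pos hθ0, hθdef,
        ← Real.rpow_mul two_pos.le, inv_mul_cancel₀ hα.ne', Real.rpow_one]⟩)
    (by simp) (by simp) (by simp)
  have hm : Tendsto (fun n : ℕ => n / 2) atTop atTop := Nat.tendsto_div_const_atTop two_ne_zero
  obtain ⟨s, hs1, hsθ⟩ := exists_between hθ1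
  have hs0 : 0 < s := one_pos.trans hs1
  have hlower : ∀ δ : ℝ, 0 < δ → ∀ᶠ n in atTop, F (a n * -δ + b n) < 1 := fun δ hδ => by
    have h1 := hs.2 (-δ) (by simpa using hδ)
    filter_upwards [h1.eventually_const_lt (Real.rpow_pos_of_pos
      (abs_pos.2 (neg_ne_zero.2 hδ.ne')) α), eventually_one_div_natCast_pos] with n hn hn'
    rw [div_pos_iff_of_pos_right hn'] at hn
    simpa using hn
  have hlim : Tendsto (fun n => F (a n * -1 + b n)) atTop (𝓝 1) := by
    have h1 := (hs.2 (-1) (by simp)).mul (tendsto_const_div_atTop_nhds_zero_nat 1)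
    have h2 := h1.const_sub 1
    rw [mul_zero, sub_zero] at h2
    refine h2.congr' ?_
    filter_upwards [eventually_one_div_natCast_pos] with n hn
    rw [div_mul_cancel₀ _ hn.ne']
    ring
  -- Along $2^jn$ the centres increase by at most $\delta(1-s^{-1})s^{-j}a_n$ per step, in total
  -- less than $\delta a_n$. So $b_n+\delta a_n$ stays above points at which $F$ tends to $1$.
  have hupper : ∀ δ : ℝ, 0 < δ → ∀ᶠ n in atTop, F (b n + δ * a n) = 1 := fun δ hδ => by
    have hε : 0 < δ * (1 - s⁻¹) := mul_pos hδ (sub_pos.2 (inv_lt_one_of_one_lt₀ hs1))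
    obtain ⟨N, hN⟩ := eventually_atTop.1 (hs.1.and ((hm.eventually hs.1).and
      ((hratio.eventually_const_lt hsθ).and (hshift.eventually_const_lt (neg_lt_zero.2 hε)))))
    filter_upwards [eventually_ge_atTop (max N 1)] with n hn
    have hn1 : N ≤ n := (le_max_left _ _).trans hn
    have hn2 : 1 ≤ n := (le_max_right _ _).trans hn
    have ha := (hN n hn1).1
    have key : ∀ j : ℕ, 0 < a (2 ^ j * n) ∧ a (2 ^ j * n) ≤ s⁻¹ ^ j * a n ∧
        b (2 ^ j * n) ≤ b n + δ * (1 - s⁻¹ ^ j) * a n := by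
      intro j
      induction j with
      | zero => simpa using ha
      | succ j ih =>
        obtain ⟨i1, i2, i3⟩ := ih
        have hle : N ≤ 2 ^ (j + 1) * n := hn1.trans (Nat.le_mul_of_pos_left _ (by positivity))
        obtain ⟨h1, -, h3, h4⟩ := hN _ hle
        have hdiv : 2 ^ (j + 1) * n / 2 = 2 ^ j * n := by
          rw [pow_succ', mul_assoc, Nat.mul_div_cancel_left _ two_pos]
        rw [hdiv] at h3 h4
        rw [lt_div_iff₀ h1] at h3 h4
        have h5 : a (2 ^ (j + 1) * n) ≤ s⁻¹ * a (2 ^ j * n) := by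
          rw [inv_mul_eq_div, le_div_iff₀ hs0]
          linarith
        have hsi : s⁻¹ ≤ 1 := inv_le_one_of_one_le₀ hs1.le
        have h6 : a (2 ^ (j + 1) * n) ≤ s⁻¹ ^ j * a n :=
          h5.trans ((mul_le_of_le_one_left i1.le hsi).trans i2)
        refine ⟨h1, ?_, ?_⟩
        · rw [pow_succ' s⁻¹, mul_assoc]
          exact h5.trans (mul_le_mul_of_nonneg_left i2 (by positivity))
        · have h7 := mul_le_mul_of_nonneg_left h6 hε.le
          rw [pow_succ s⁻¹]
          linarith
    have htop : Tendsto (fun j : ℕ => 2 ^ j * n) atTop atTop :=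
      (tendsto_pow_atTop_atTop_of_one_lt one_lt_two).atTop_mul_const' (by omega)
    refine le_antisymm (hF.le_one _) (le_of_tendsto' (hlim.comp htop) fun j => hF.mono ?_)
    obtain ⟨h1, -, h3⟩ := key j
    have h4 : 0 < s⁻¹ ^ j := by positivity
    have h5 : 0 < δ * s⁻¹ ^ j * a n := by positivity
    nlinarith
  have hlt := coe_lt_rightEnd_iff hF hc
  obtain ⟨n₀, hn₀⟩ := (hupper 1 one_pos).exists
  obtain ⟨n₁, hn₁⟩ := (hlower 1 one_pos).exists
  have htop : rightEnd F ≠ ⊤ := fun h => by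
    have := (hlt (b n₀ + 1 * a n₀)).1 (h ▸ EReal.coe_lt_top _)
    exact this.ne hn₀
  have hbot : rightEnd F ≠ ⊥ := ((EReal.bot_lt_coe _).trans ((hlt _).2 hn₁)).ne'
  have hρ := EReal.coe_toReal htop hbot
  refine ⟨(rightEnd F).toReal, hρ.symm, a, hs.congr_shift hF.mono eventually_one_div_natCast_pos
    isOpen_Iio continuousOn_abs_rpow ?_⟩
  have hlt' : ∀ x : ℝ, x < (rightEnd F).toReal ↔ F x < 1 := fun x => by
    rw [← hlt x, ← hρ, EReal.coe_lt_coe_iff, EReal.toReal_coe]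
  -- `hlower` puts $b_n-\delta a_n$ below the endpoint and `hupper` puts $b_n+\delta a_n$ at or
  -- beyond it, so the centres are within $o(a_n)$ of the endpoint.
  refine tendsto_order.2 ⟨fun c hc0 => ?_, fun c hc0 => ?_⟩
  · filter_upwards [hlower (-c) (by linarith), hs.1] with n hn han
    rw [← hlt'] at hn
    rw [lt_div_iff₀ han]
    linarith
  · filter_upwards [hupper (c / 2) (by linarith), hs.1] with n hn han
    have h1 : (rightEnd F).toReal ≤ b n + c / 2 * a n :=
      le_of_not_gt fun h => ((hlt' _).1 h).ne hn
    rw [div_lt_iff₀ han]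
    nlinarith

lemma weibull_rightEnd (hF : IsDF F) (hc : Continuous F) (hα : 0 < α)
    (h : InMaxDomain F (weibull α)) : rightEnd F < ⊤ := by
  obtain ⟨ρ, hρ, -⟩ := weibull_scaledTail hF hc hα h
  exact hρ ▸ EReal.coe_lt_top ρ

lemma T_maxConverges_weibull (hF : IsDF F) (hc : Continuous F) (hr : 0 < r) (hk : 1 ≤ k)
    (hα : 0 < α) (h : InMaxDomain F (weibull α)) :
    MaxConverges (T F r k) (weibull (k * α))
      (fun n => (rightEnd F).toReal -
        genInv F (1 - ((k : ℝ) * ProbabilityTheory.beta r k / (n : ℝ)) ^ (1 / (k : ℝ))))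
      (fun _ => (rightEnd F).toReal) := by
  obtain ⟨ρ, hρ, a, hs⟩ := weibull_scaledTail hF hc hα h
  have hlt := coe_lt_rightEnd_iff hF hc
  rw [hρ] at hlt ⊢
  rw [EReal.toReal_coe]
  obtain ⟨hp, hp0, hpk⟩ := tendsto_scale_pow hr hk
  have hs' := hs.of_nat hp hp0
  set A := fun n : ℕ => genInv F
    (1 - ((k : ℝ) * ProbabilityTheory.beta r k / (n : ℝ)) ^ (1 / (k : ℝ)))
  have hq := tendsto_tail_genInv hF hc hp hp0
  change Tendsto (fun n => (1 - F (A n)) / _) _ _ at hq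
  have hA := hs'.tendsto_point (z := A) (y := -1) hF.mono hp isOpen_Iio
    (strictAntiOn_abs_rpow hα) (by simp) (by simpa using hq)
  have hApos : ∀ᶠ n in atTop, 0 < ρ - A n := by
    filter_upwards [hA.eventually_lt_const (by simp : (-1 : ℝ) < 0), hs'.1] with n hn hn'
    rw [div_lt_iff₀ hn'] at hn
    linarith
  refine ⟨hApos, fun x _ => ?_⟩
  rcases lt_or_ge x 0 with hx | hx
  · have h1 := hs'.tendsto_of_point (z := fun n => (ρ - A n) * x + ρ) hF.mono hp isOpen_Iio hx
      (continuousOn_abs_rpow.continuousAt (Iio_mem_nhds hx)) (by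
        have := hA.mul_const (-x)
        rw [neg_mul_neg, one_mul] at this
        exact this.congr fun n => by ring)
    have h2 := tendsto_T_pow hF hc hr hk hp hp0 hpk
      (Real.rpow_pos_of_pos (abs_pos.2 hx.ne) _) h1
    rwa [← Real.rpow_mul_natCast (abs_nonneg x), mul_comm α, ← (continuousAt_weibull hx).2] at h2
  · rw [weibull, if_neg hx.not_gt]
    refine tendsto_const_nhds.congr' ?_
    filter_upwards [hApos] with n hn
    -- For $x\ge0$ the point lies at or beyond the endpoint, where $T_k=1$.
    have h1 : ρ ≤ (ρ - A n) * x + ρ := by nlinarith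
    have h2 : ¬ T F r k ((ρ - A n) * x + ρ) < 1 := by
      rw [T_lt_one_iff hF hr hk, ← hlt, EReal.coe_lt_coe_iff]
      exact h1.not_gt
    rw [le_antisymm ((T_isDF hF hc hr hk).le_one _) (not_lt.1 h2), one_pow]

end Weibull

/-! ### The Gumbel domain. -/

section Gumbel

lemma strictAntiOn_exp_neg : StrictAntiOn (fun x : ℝ => Real.exp (-x)) Set.univ :=
  fun _ _ _ _ h => Real.exp_lt_exp.2 (neg_lt_neg h)

/-- In the Gumbel domain there is a scale `a` for which the tail ratios converge on the whole
line. -/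
lemma gumbel_scaledTail (hF : IsDF F) (hc : Continuous F) (h : InMaxDomain F gumbel) :
    ∃ a : ℝ → ℝ, ScaledTail F (fun x => Real.exp (-x)) Set.univ (toRightEnd F)
      (fun t => 1 - F t) a (fun t => t) := by
  obtain ⟨a, b, hab⟩ := h
  have hs := hab.scaledTail (φ := fun x => Real.exp (-x)) (I := Set.univ) hF.nonneg
    fun _ _ => ⟨by unfold gumbel; fun_prop, rfl⟩
  have hF1 := tendsto_nhdsWithin_iff.1 (tendsto_apply_toRightEnd hF hc)
  have hp : ∀ᶠ t in toRightEnd F, 0 < 1 - F t := hF1.2.mono fun t ht => sub_pos.2 ht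
  have hp0 : Tendsto (fun t => 1 - F t) (toRightEnd F) (𝓝 0) := by
    simpa using hF1.1.const_sub 1
  have hs' := hs.of_nat hp hp0
  refine ⟨_, hs'.congr_shift hF.mono hp isOpen_univ (by fun_prop) ?_⟩
  -- On the scale $1-F(t)$ the tail at $t$ itself is $1=e^{-0}$, so $t$ may replace the centre.
  refine hs'.tendsto_point (z := fun t => t) hF.mono hp isOpen_univ strictAntiOn_exp_neg
    (Set.mem_univ 0) ?_
  rw [neg_zero, Real.exp_zero]
  refine tendsto_const_nhds.congr' (hp.mono fun t ht => ?_)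
  exact (div_self ht.ne').symm

lemma exists_isAuxiliary (hF : IsDF F) (hc : Continuous F) (h : InMaxDomain F gumbel) :
    ∃ v, IsAuxiliary F v := by
  obtain ⟨a, ha⟩ := gumbel_scaledTail hF hc h
  -- `a` is positive only near the endpoint; the value $1$ elsewhere secures positivity.
  refine ⟨fun t => if 0 < a t then a t else 1, fun t _ => ?_, fun x _ => ?_⟩
  · dsimp only
    split_ifs with h
    exacts [h, one_pos]
  · refine (ha.2 x (Set.mem_univ x)).congr' (ha.1.mono fun t ht => ?_)
    dsimp only
    rw [if_pos ht, add_comm]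

/-- The defining limit of an auxiliary function holds on the whole line. -/
lemma IsAuxiliary.tendsto (hF : IsDF F) (hc : Continuous F) (h : InMaxDomain F gumbel)
    {v : ℝ → ℝ} (hv : IsAuxiliary F v) (x : ℝ) :
    Tendsto (fun t => (1 - F (t + v t * x)) / (1 - F t)) (toRightEnd F)
      (𝓝 (Real.exp (-x))) := by
  obtain ⟨a, ha⟩ := gumbel_scaledTail hF hc h
  have hp : ∀ᶠ t in toRightEnd F, 0 < 1 - F t :=
    (tendsto_nhdsWithin_iff.1 (tendsto_apply_toRightEnd hF hc)).2.mono fun t ht => sub_pos.2 ht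
  -- The limit at $x=1$ alone forces $v(t)/a(t)\to1$, and hence the limits at all real $x$.
  have h1 : Tendsto (fun t => (t + v t * 1 - t) / a t) (toRightEnd F) (𝓝 1) :=
    ha.tendsto_point (y := 1) hF.mono hp isOpen_univ
    strictAntiOn_exp_neg (Set.mem_univ 1) (hv.2 1 zero_le_one)
  refine ha.tendsto_of_point hF.mono hp isOpen_univ (Set.mem_univ x)
    (by fun_prop) ?_
  have := h1.mul_const x
  rw [one_mul] at this
  exact this.congr fun t => by ring

lemma T_maxConverges_gumbel (hF : IsDF F) (hc : Continuous F) (hr : 0 < r) (hk : 1 ≤ k)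
    (h : InMaxDomain F gumbel) {v : ℝ → ℝ} (hv : IsAuxiliary F v) :
    MaxConverges (T F r k) gumbel
      (fun n => v (genInv (T F r k) (1 - 1 / (n : ℝ))) / (k : ℝ))
      (fun n => genInv (T F r k) (1 - 1 / (n : ℝ))) := by
  have hk0 : (0 : ℝ) < k := by exact_mod_cast hk
  have hB := beta_pos hr hk
  set b := fun n : ℕ => genInv (T F r k) (1 - 1 / (n : ℝ)) with hb
  have hT := T_isDF hF hc hr hk
  have hTb : ∀ᶠ n : ℕ in atTop, 1 - T F r k (b n) = 1 / (n : ℝ) := by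
    filter_upwards [eventually_ge_atTop 2] with n hn
    have hn' : (2 : ℝ) ≤ n := by exact_mod_cast hn
    have h1 : 1 / (n : ℝ) < 1 := by rw [div_lt_one] <;> linarith
    have h2 : 0 < 1 / (n : ℝ) := by positivity
    rw [hb, apply_genInv hT (T_continuous hF hc hr hk) (by linarith) (by linarith)]
    ring
  have hbr : Tendsto b atTop (toRightEnd F) := by
    have h1 : toRightEnd F = toRightEnd (T F r k) := by simp only [toRightEnd, rightEnd_T hF hr hk]
    rw [h1, tendsto_toRightEnd_iff hT (T_continuous hF hc hr hk)]
    constructor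
    · filter_upwards [hTb, eventually_one_div_natCast_pos] with n hn hn'
      linarith
    · have h2 := (tendsto_const_div_atTop_nhds_zero_nat (1 : ℝ)).const_sub 1
      rw [sub_zero] at h2
      refine h2.congr' (hTb.mono fun n hn => ?_)
      rw [← hn]
      ring
  have hFb := (tendsto_toRightEnd_iff hF hc).1 hbr
  have hp : ∀ᶠ n in atTop, 0 < 1 - F (b n) := hFb.1.mono fun n hn => sub_pos.2 hn
  have hp0 : Tendsto (fun n => 1 - F (b n)) atTop (𝓝 0) := by simpa using hFb.2.const_sub 1
  -- The scale is $p_n=1-F(b_n)$; since $1-T_k(b_n)=1/n$, the tail ratio gives $np_n^k\to kB$.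
  have hpk : Tendsto (fun n : ℕ => (n : ℝ) * (1 - F (b n)) ^ k) atTop
      (𝓝 ((k : ℝ) * ProbabilityTheory.beta r k)) := by
    have h1 := ((tendsto_one_sub_T_div hF hc hr hk).comp hbr).inv₀ (by positivity)
    rw [one_div, inv_inv] at h1
    refine h1.congr' ?_
    filter_upwards [hTb] with n hn
    simp only [Function.comp_apply]
    rw [hn, inv_div, div_div_eq_mul_div, div_one, mul_comm]
  refine ⟨?_, fun x _ => ?_⟩
  · filter_upwards [hFb.1] with n hn
    exact div_pos (hv.1 _ ((coe_lt_rightEnd_iff hF hc _).2 hn)) hk0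
  -- Evaluating at $x/k$ absorbs the power: $(e^{-x/k})^k=e^{-x}$, whence the scale $v(b_n)/k$.
  · have h1 := (hv.tendsto hF hc h (x / k)).comp hbr
    have h2 := tendsto_T_pow (z := fun n => v (b n) / k * x + b n) hF hc hr hk hp hp0 hpk
      (Real.exp_pos (-(x / k))) (h1.congr fun n => by
        simp only [Function.comp_apply]
        congr 3
        ring)
    rw [← Real.exp_nat_mul, mul_neg, mul_div_cancel₀ _ hk0.ne'] at h2
    exact h2

end Gumbel

end Domains

end KthExtremes

end

theorem mainTheorem6 (F f : ℝ → ℝ) (hF : KthExtremes.IsDF F) (hf : KthExtremes.HasDensity F f)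
    (k : ℕ) (hk : 1 ≤ k) (r : ℝ) (hr : 0 < r) :
    -- (a)
    (KthExtremes.IsDF (KthExtremes.T F r k) ∧
      KthExtremes.HasDensity (KthExtremes.T F r k) (KthExtremes.tDensity F f r k) ∧
      KthExtremes.rightEnd (KthExtremes.T F r k) = KthExtremes.rightEnd F ∧
      Tendsto (fun x => (1 - KthExtremes.T F r k x) / (1 - F x) ^ k) (KthExtremes.toRightEnd F)
        (𝓝 (1 / ((k : ℝ) * ProbabilityTheory.beta r k))) ∧
      KthExtremes.TailEquivalent (KthExtremes.T F r k) (KthExtremes.H F k)) ∧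
    -- (b)
    (∀ α : ℝ, 0 < α → KthExtremes.InMaxDomain F (KthExtremes.frechet α) →
      KthExtremes.rightEnd (KthExtremes.T F r k) = KthExtremes.rightEnd F ∧
      KthExtremes.rightEnd F = ⊤ ∧
      KthExtremes.InMaxDomain (KthExtremes.T F r k) (KthExtremes.frechet (k * α)) ∧
      KthExtremes.MaxConverges (KthExtremes.T F r k) (KthExtremes.frechet (k * α))
        (fun n => KthExtremes.genInv F
          (1 - ((k : ℝ) * ProbabilityTheory.beta r k / (n : ℝ)) ^ (1 / (k : ℝ))))
        (fun _ => 0)) ∧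
    -- (c)
    (∀ α : ℝ, 0 < α → KthExtremes.InMaxDomain F (KthExtremes.weibull α) →
      KthExtremes.rightEnd (KthExtremes.T F r k) = KthExtremes.rightEnd F ∧
      KthExtremes.rightEnd F < ⊤ ∧
      KthExtremes.InMaxDomain (KthExtremes.T F r k) (KthExtremes.weibull (k * α)) ∧
      KthExtremes.MaxConverges (KthExtremes.T F r k) (KthExtremes.weibull (k * α))
        (fun n => (KthExtremes.rightEnd F).toReal - KthExtremes.genInv F
          (1 - ((k : ℝ) * ProbabilityTheory.beta r k / (n : ℝ)) ^ (1 / (k : ℝ))))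
        (fun _ => (KthExtremes.rightEnd F).toReal)) ∧
    -- (d)
    (KthExtremes.InMaxDomain F KthExtremes.gumbel →
      KthExtremes.rightEnd (KthExtremes.T F r k) = KthExtremes.rightEnd F ∧
      KthExtremes.InMaxDomain (KthExtremes.T F r k) KthExtremes.gumbel ∧
      (∃ v : ℝ → ℝ, KthExtremes.IsAuxiliary F v) ∧
      ∀ v : ℝ → ℝ, KthExtremes.IsAuxiliary F v →
        KthExtremes.MaxConverges (KthExtremes.T F r k) KthExtremes.gumbel
          (fun n => v (KthExtremes.genInv (KthExtremes.T F r k) (1 - 1 / (n : ℝ))) / (k : ℝ))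
          (fun n => KthExtremes.genInv (KthExtremes.T F r k) (1 - 1 / (n : ℝ)))) := by
  have hc := hf.continuous
  have hR := KthExtremes.rightEnd_T hF hr hk
  refine ⟨⟨KthExtremes.T_isDF hF hc hr hk, KthExtremes.T_hasDensity hF hf hr hk, hR,
    KthExtremes.tendsto_one_sub_T_div hF hc hr hk,
    KthExtremes.T_tailEquivalent_H hF hc hr hk⟩, fun α hα h => ?_, fun α hα h => ?_, fun h => ?_⟩
  · have hM := KthExtremes.T_maxConverges_frechet hF hc hr hk hα h
    exact ⟨hR, KthExtremes.frechet_rightEnd hF hc hα h, ⟨_, _, hM⟩, hM⟩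
  · have hM := KthExtremes.T_maxConverges_weibull hF hc hr hk hα h
    exact ⟨hR, KthExtremes.weibull_rightEnd hF hc hα h, ⟨_, _, hM⟩, hM⟩
  · obtain ⟨v, hv⟩ := KthExtremes.exists_isAuxiliary hF hc h
    exact ⟨hR, ⟨_, _, KthExtremes.T_maxConverges_gumbel hF hc hr hk h hv⟩, ⟨v, hv⟩,
      fun w hw => KthExtremes.T_maxConverges_gumbel hF hc hr hk h hw⟩
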